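/- Let $r,d,N$ be natural numbers. An integer square matrix is called expansive if all its complex eigenvalues have modulus $>1$. For an expansive $R\in M_n(\mathbb Z)$ and finite sets $B,L\subset\mathbb Z^n$ with $0\in B\cap L$ and $\#B=\#L$, the system $(R,B,L)$ is a Hadamard triple if the matrix $\frac1{\sqrt{\#B}}\big[e^{2\pi i\langle R^{-1}b,\ell\rangle}\big]_{\ell\in L,\,b\in B}$ is unitary. For a finite set $A\subset\mathbb R^n$ put $\delta_A=\frac1{\#A}\sum_{a\in A}\delta_a$. Infinite convolutions are weak limits of the finite convolutions, and $\mu_{R,B}=\delta_{R^{-1}B}*\delta_{R^{-2}B}*\cdots$ is the self-affine measure of $(R,B)$. A countable set $\Lambda\subset\mathbb R^n$ is a spectrum for a Borel probability measure $\mu$ on $\mathbb R^n$ if the family $(e^{2\pi i\langle\lambda,\cdot\rangle})_{\lambda\in\Lambda}$ is an orthonormal basis of $L^2(\mu)$. Let $(R,B(i),L)$, $i=1,\dots,N$, be Hadamard triples with $R\in M_d(\mathbb Z)$ and $B(i),L\subset\mathbb Z^d$ (with the same $R$ and $L$ for all $i$). Let $(R_1,B_1,L_1)$ be a Hadamard triple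 with $R_1\in M_r(\mathbb Z)$, $L_1\subset\mathbb Z^r$ and $B_1=\{a_1,\dots,a_N\}\subset\mathbb Z^r$, where $a_1,\dots,a_N$ are pairwise distinct, and let $C\in M_{d,r}(\mathbb Z)$. Let $(\mathbf R,\mathbf B,\mathbf L)$ be the associated triple in quasi-product form on $\mathbb R^{r+d}$, that is, $$\mathbf R=\begin{bmatrix}R_1&0\\ C&R\end{bmatrix},\qquad \mathbf B=\left\{\begin{bmatrix}a_i\\ b\end{bmatrix}: 1\le i\le N,\ b\in B(i)\right\},\qquad \mathbf L=L_1\times L .$$ For $\omega=\omega_1\omega_2\dots\in\{1,\dots,N\}^{\mathbb N}$ let $\mu_\omega=\delta_{R^{-1}B(\omega_1)}*\delta_{R^{-2}B(\omega_2)}*\cdots$, and let $\mathbb P$ be the product probability measure on $\{1,\dots,N\}^{\mathbb N}$ under which the letters are independent and uniformly distributed on $\{1,\dots,N\}$. Let $\Lambda_1\subset\mathbb R^r$ be a spectrum for $\mu_1:=\mu_{R_1,B_1}$, and let $\Lambda_2\subset\mathbb R^d$ be any subset. Then $\Lambda_1\times\Lambda_2$ is a spectrum for $\mu_{\mathbf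 R,\mathbf B}$ if and only if $\Lambda_2$ is a spectrum for $\mu_\omega$ for $\mathbb P$-almost every $\omega$. -/

import Mathlib

open MeasureTheory Filter Topology
open scoped BoundedContinuousFunction ENNReal Matrix

noncomputable section

namespace QuasiProduct

/-! Points of the `n`-dimensional real space are functions `ι → ℝ` on a finite index type `ι`
with `n` elements, and the standard inner product is the dot product `⬝ᵥ`.  Norms play no
role in the definitions below, only the (Borel, topological and linear) structure does. -/

section Spectra

variable {ι : Type*} [Fintype ι]

/-- The exponential function `x ↦ exp (2 π i ⟨ξ, x⟩)`. -/
def expo (ξ x : ι → ℝ) : ℂ :=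
  Complex.exp (2 * Real.pi * Complex.I * ((ξ ⬝ᵥ x : ℝ) : ℂ))

/-- `Λ` is a spectrum of `μ`: it is countable and the exponentials with frequencies in `Λ`
form an orthonormal basis (indexed by `Λ`) of the complex Hilbert space `L²(μ)`. -/
def IsSpectrum (μ : Measure (ι → ℝ)) (Λ : Set (ι → ℝ)) : Prop :=
  Λ.Countable ∧
    ∃ b : HilbertBasis Λ ℂ (Lp ℂ 2 μ), ∀ l : Λ, (b l : (ι → ℝ) → ℂ) =ᵐ[μ] expo (l : ι → ℝ)

end Spectra

section Hadamard

variable {ι : Type*} [Fintype ι] [DecidableEq ι]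

/-- An integer matrix is expansive if all its complex eigenvalues have modulus greater
than one. -/
def IsExpansive (R : Matrix ι ι ℤ) : Prop :=
  ∀ z ∈ spectrum ℂ (R.map (Int.cast : ℤ → ℂ)), 1 < ‖z‖

/-- The real matrix `R⁻¹`. -/
def realInv (R : Matrix ι ι ℤ) : Matrix ι ι ℝ := (R.map (Int.cast : ℤ → ℝ))⁻¹

/-- An integer vector as a real vector. -/
def realVec (b : ι → ℤ) : ι → ℝ := fun i => (b i : ℝ)

/-- The matrix `(#B)^(-1/2) [exp (2 π i ⟨R⁻¹ b, l⟩)]` with rows `l ∈ L` and columns `b ∈ B`. -/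
def hadamardMatrix (R : Matrix ι ι ℤ) (B L : Finset (ι → ℤ)) : Matrix L B ℂ :=
  Matrix.of fun l b =>
    ((1 / Real.sqrt (B.card : ℝ) : ℝ) : ℂ) *
      expo (realInv R *ᵥ realVec (b : ι → ℤ)) (realVec (l : ι → ℤ))

/-- `(R, B, L)` is a Hadamard triple. -/
structure IsHadamardTriple (R : Matrix ι ι ℤ) (B L : Finset (ι → ℤ)) : Prop where
  expansive : IsExpansive R
  zero_mem_digits : (0 : ι → ℤ) ∈ B
  zero_mem_freqs : (0 : ι → ℤ) ∈ L
  card_eq : B.card = L.card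
  unitary : (hadamardMatrix R B L)ᴴ * hadamardMatrix R B L = 1

end Hadamard

section Convolutions

/-- The uniform probability measure `δ_A = (1 / #A) ∑_{a ∈ A} δ_a` on a finite set `A`. -/
def uniformMeasure {X : Type*} [MeasurableSpace X] (A : Finset X) : Measure X :=
  ((A.card : ℝ≥0∞)⁻¹) • ∑ a ∈ A, Measure.dirac a

variable {ι : Type*} [Fintype ι]

/-- The finite convolution `ν 0 ∗ ν 1 ∗ ⋯ ∗ ν (n - 1)`. -/
def finiteConvolution (ν : ℕ → Measure (ι → ℝ)) : ℕ → Measure (ι → ℝ)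
  | 0 => Measure.dirac 0
  | n + 1 => (finiteConvolution ν n).conv (ν n)

/-- `μ` is the infinite convolution `ν 0 ∗ ν 1 ∗ ⋯`: a Borel probability measure which is the
weak limit of the finite convolutions. -/
def IsInfiniteConvolution (ν : ℕ → Measure (ι → ℝ)) (μ : Measure (ι → ℝ)) : Prop :=
  IsProbabilityMeasure μ ∧
    ∀ f : (ι → ℝ) →ᵇ ℝ,
      Tendsto (fun n => ∫ x, f x ∂(finiteConvolution ν n)) atTop (𝓝 (∫ x, f x ∂μ))

open Classical in
/-- The infinite convolution `ν 0 ∗ ν 1 ∗ ⋯`, where it exists (it is then unique). -/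
def infiniteConvolution (ν : ℕ → Measure (ι → ℝ)) : Measure (ι → ℝ) :=
  if h : ∃ μ, IsInfiniteConvolution ν μ then h.choose else Measure.dirac 0

variable [DecidableEq ι]

/-- The finite set `R⁻ᵏ B` of real vectors. -/
def scaledDigits (R : Matrix ι ι ℤ) (k : ℕ) (B : Finset (ι → ℤ)) : Finset (ι → ℝ) :=
  B.image fun b => (realInv R ^ k) *ᵥ realVec b

/-- The random convolution `μ_ω = δ_{R⁻¹ B(ω₁)} ∗ δ_{R⁻² B(ω₂)} ∗ ⋯`; the word
`ω = ω₁ ω₂ …` is numbered from zero, so that `ω_{n+1}` is `ω n`. -/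
def randomConvolution {κ : Type*} (R : Matrix ι ι ℤ) (B : κ → Finset (ι → ℤ)) (ω : ℕ → κ) :
    Measure (ι → ℝ) :=
  infiniteConvolution fun n => uniformMeasure (scaledDigits R (n + 1) (B (ω n)))

/-- The self-affine measure `μ_{R,B} = δ_{R⁻¹ B} ∗ δ_{R⁻² B} ∗ ⋯`. -/
def selfAffineMeasure (R : Matrix ι ι ℤ) (B : Finset (ι → ℤ)) : Measure (ι → ℝ) :=
  infiniteConvolution fun n => uniformMeasure (scaledDigits R (n + 1) B)

end Convolutions

/-- The probability `ℙ` on infinite words over an alphabet of `N` letters, under which the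
letters are independent and uniformly distributed. -/
def wordMeasure (N : ℕ) : Measure (ℕ → Fin N) :=
  Measure.infinitePi fun _ => uniformMeasure (Finset.univ : Finset (Fin N))

/-- The triple `(bigR, bigB, bigL)` is in quasi-product form on the real space of dimension
`r + d`, with first component `(R₁, {a i}, L₁)`, and associated with `(R, B i, L)`, `i : Fin N`.
The vectors `a i` are pairwise distinct, and `0 ∈ {a i}`, `0 ∈ B i` are part of the Hadamard
triple conditions. -/
structure IsQuasiProductForm {r d N : ℕ}
    (bigR : Matrix (Fin r ⊕ Fin d) (Fin r ⊕ Fin d) ℤ) (bigB bigL : Finset (Fin r ⊕ Fin d → ℤ))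
    (R₁ : Matrix (Fin r) (Fin r) ℤ) (a : Fin N → Fin r → ℤ) (L₁ : Finset (Fin r → ℤ))
    (R : Matrix (Fin d) (Fin d) ℤ) (B : Fin N → Finset (Fin d → ℤ)) (L : Finset (Fin d → ℤ)) :
    Prop where
  hadamard : ∀ i, IsHadamardTriple R (B i) L
  hadamard_first : IsHadamardTriple R₁ (Finset.univ.image a) L₁
  injective_first : Function.Injective a
  matrix_eq : ∃ C : Matrix (Fin d) (Fin r) ℤ, bigR = Matrix.fromBlocks R₁ 0 C R
  mem_digits_iff : ∀ v, v ∈ bigB ↔ ∃ i, ∃ b ∈ B i, v = Sum.elim (a i) b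
  mem_freqs_iff : ∀ v, v ∈ bigL ↔ ∃ l₁ ∈ L₁, ∃ l ∈ L, v = Sum.elim l₁ l

/-- The product `Λ₁ × Λ₂`, as a set of points of the real space of dimension `r + d`. -/
def prodSet {r d : ℕ} (Λ₁ : Set (Fin r → ℝ)) (Λ₂ : Set (Fin d → ℝ)) :
    Set (Fin r ⊕ Fin d → ℝ) :=
  Set.image2 Sum.elim Λ₁ Λ₂

section WellDefined

lemma IsInfiniteConvolution.unique {ι : Type*} [Fintype ι] {ν : ℕ → Measure (ι → ℝ)}
    {μ μ' : Measure (ι → ℝ)} (h : IsInfiniteConvolution ν μ) (h' : IsInfiniteConvolution ν μ') :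
    μ = μ' := by
  have := h.1
  have := h'.1
  exact ext_of_forall_integral_eq_of_IsFiniteMeasure
    fun f => tendsto_nhds_unique (h.2 f) (h'.2 f)

lemma isInfiniteConvolution_infiniteConvolution {ι : Type*} [Fintype ι]
    {ν : ℕ → Measure (ι → ℝ)} (h : ∃ μ, IsInfiniteConvolution ν μ) :
    IsInfiniteConvolution ν (infiniteConvolution ν) := by
  rw [infiniteConvolution, dif_pos h]
  exact h.choose_spec

lemma isProbabilityMeasure_uniformMeasure {X : Type*} [MeasurableSpace X] {A : Finset X}
    (hA : A.Nonempty) : IsProbabilityMeasure (uniformMeasure A) := by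
  constructor
  have h0 : (A.card : ℝ≥0∞) ≠ 0 := by
    simpa using hA.ne_empty
  simp [uniformMeasure, ENNReal.inv_mul_cancel h0 (ENNReal.natCast_ne_top _)]

lemma ae_mem_uniformMeasure {X : Type*} [MeasurableSpace X] [MeasurableSingletonClass X]
    (A : Finset X) : ∀ᵐ x ∂(uniformMeasure A), x ∈ A := by
  rw [ae_iff, uniformMeasure, Measure.smul_apply, Measure.finsetSum_apply]
  rw [Finset.sum_eq_zero, smul_zero]
  intro a ha
  rw [Measure.dirac_apply]
  simp [ha]

attribute [local instance] Matrix.linftyOpNormedRing Matrix.linftyOpNormedAlgebra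

variable {ι : Type*} [Fintype ι] [DecidableEq ι]

lemma realInv_map {R : Matrix ι ι ℤ} (hR : IsExpansive R) :
    IsUnit (R.map (Int.cast : ℤ → ℂ)) ∧
      (realInv R).map Complex.ofReal = (R.map (Int.cast : ℤ → ℂ))⁻¹ := by
  have hu : IsUnit (R.map (Int.cast : ℤ → ℂ)) := by
    by_contra h
    have := hR 0 (by rwa [spectrum.zero_mem_iff])
    simp at this
    linarith
  refine ⟨hu, ?_⟩
  have hmap : R.map (Int.cast : ℤ → ℂ) = (R.map (Int.cast : ℤ → ℝ)).map Complex.ofReal := by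
    ext i j; simp
  have hdet : IsUnit (R.map (Int.cast : ℤ → ℝ)).det := by
    rw [isUnit_iff_ne_zero]
    intro h
    have h2 := (Matrix.isUnit_iff_isUnit_det _).1 hu
    rw [hmap] at h2
    have h3 := (RingHom.map_det Complex.ofRealHom (R.map (Int.cast : ℤ → ℝ)))
    rw [h] at h3
    simp only [RingHom.mapMatrix_apply, map_zero] at h3
    rw [show (R.map (Int.cast : ℤ → ℝ)).map Complex.ofReal
      = (R.map (Int.cast : ℤ → ℝ)).map Complex.ofRealHom from rfl, ← h3] at h2
    simp at h2
  symm
  apply Matrix.inv_eq_left_inv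
  rw [hmap]
  have := congrArg (Complex.ofRealHom.mapMatrix) (Matrix.nonsing_inv_mul _ hdet)
  rw [map_mul, map_one] at this
  exact this

lemma summable_norm_realInv_pow {R : Matrix ι ι ℤ} (hR : IsExpansive R) :
    Summable fun k : ℕ => ‖realInv R ^ k‖ := by
  cases isEmpty_or_nonempty ι with
  | inl h =>
    have : (fun k : ℕ => ‖realInv R ^ k‖) = fun _ => 0 := by
      funext k
      rw [norm_eq_zero]
      exact Subsingleton.elim _ _
    rw [this]; exact summable_zero
  | inr h =>
  obtain ⟨hu, hmap⟩ := realInv_map hR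
  set A : Matrix ι ι ℂ := (realInv R).map Complex.ofReal with hA
  have hn : ∀ k : ℕ, ‖realInv R ^ k‖ = ‖A ^ k‖ := by
    intro k
    have h1 : A ^ k = (realInv R ^ k).map Complex.ofReal := by
      have := map_pow (Complex.ofRealHom.mapMatrix) (realInv R) k
      exact this.symm
    rw [h1, Matrix.linfty_opNorm_def, Matrix.linfty_opNorm_def]
    simp [Matrix.map_apply]
  simp_rw [hn]
  have hsp : ∀ z ∈ spectrum ℂ A, ‖z‖₊ < 1 := by
    intro z hz
    obtain ⟨u, hu'⟩ := hu
    have hAu : A = ((u⁻¹ : (Matrix ι ι ℂ)ˣ) : Matrix ι ι ℂ) := by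
      rw [hmap, ← hu', Matrix.coe_units_inv]
    have hz0 : z ≠ 0 := by
      rintro rfl
      rw [hAu] at hz
      exact (spectrum.zero_notMem_iff ℂ).2 (Units.isUnit _) hz
    have h2 : ((Units.mk0 z hz0)⁻¹ : ℂˣ).val ∈ spectrum ℂ (u : Matrix ι ι ℂ) := by
      have := (spectrum.inv_mem_iff (r := Units.mk0 z hz0) (a := u⁻¹)).1 (by
        rw [← hAu]; exact hz)
      simpa using this
    rw [hu'] at h2
    have h3 := hR _ h2
    simp only [Units.val_inv_eq_inv_val, Units.val_mk0, norm_inv] at h3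
    have hp : 0 < ‖z‖ := norm_pos_iff.2 hz0
    have : ‖z‖ < 1 := by
      by_contra hc
      exact absurd (inv_le_one_of_one_le₀ (not_lt.1 hc)) (not_le.2 h3)
    exact_mod_cast this
  have hr : spectralRadius ℂ A < ((1 : NNReal) : ℝ≥0∞) :=
    spectrum.spectralRadius_lt_of_forall_lt A hsp
  obtain ⟨q, hq1, hq2⟩ := ENNReal.lt_iff_exists_nnreal_btwn.1 hr
  have hev := (spectrum.pow_nnnorm_pow_one_div_tendsto_nhds_spectralRadius A).eventually_lt_const hq1
  have hq2' : q < 1 := by exact_mod_cast hq2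
  refine Summable.of_norm_bounded_eventually_nat (g := fun k : ℕ => (q : ℝ) ^ k)
    (summable_geometric_of_lt_one q.2 (by exact_mod_cast hq2')) ?_
  filter_upwards [hev, eventually_gt_atTop 0] with k hk hk0
  rw [norm_norm]
  have hk0' : (0 : ℝ) < k := by exact_mod_cast hk0
  have h5 : ((‖A ^ k‖₊ : ℝ≥0∞)) ≤ (q : ℝ≥0∞) ^ k := by
    have h6 := ENNReal.rpow_le_rpow hk.le hk0'.le
    rwa [← ENNReal.rpow_mul, one_div, inv_mul_cancel₀ hk0'.ne', ENNReal.rpow_one,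
      ENNReal.rpow_natCast] at h6
  have h7 : ‖A ^ k‖₊ ≤ q ^ k := by exact_mod_cast h5
  exact_mod_cast h7

/-- The infinite convolution of uniform measures on finite sets exists as soon as these sets
lie in balls with summable radii. -/
lemma exists_isInfiniteConvolution {D : ℕ → Finset (ι → ℝ)} (hD : ∀ n, (D n).Nonempty)
    {c : ℕ → ℝ} (hc : Summable c) (hb : ∀ n, ∀ x ∈ D n, ‖x‖ ≤ c n) :
    ∃ μ, IsInfiniteConvolution (fun n => uniformMeasure (D n)) μ := by
  have : ∀ n, IsProbabilityMeasure (uniformMeasure (D n)) :=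
    fun n => isProbabilityMeasure_uniformMeasure (hD n)
  let P : Measure (ℕ → ι → ℝ) := Measure.infinitePi fun n => uniformMeasure (D n)
  have hind : ProbabilityTheory.iIndepFun (fun (n : ℕ) (x : ℕ → ι → ℝ) => x n) P :=
    ProbabilityTheory.iIndepFun_infinitePi (X := fun _ x => x) (fun _ => measurable_id)
  have hmeas : ∀ n, Measurable (fun x : ℕ → ι → ℝ => x n) := fun n => measurable_pi_apply n
  have hSn : ∀ n, Measurable (∑ k ∈ Finset.range n, fun x : ℕ → ι → ℝ => x k) := by
    intro n
    have h1 : (∑ k ∈ Finset.range n, fun x : ℕ → ι → ℝ => x k) =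
        fun x => ∑ k ∈ Finset.range n, x k := by
      funext x
      simp only [Finset.sum_apply]
    rw [h1]
    exact Finset.measurable_sum (Finset.range n) fun k _ => hmeas k
  have hlaw : ∀ n, finiteConvolution (fun n => uniformMeasure (D n)) n =
      P.map (∑ k ∈ Finset.range n, fun x : ℕ → ι → ℝ => x k) := by
    intro n
    induction n with
    | zero =>
      rw [Finset.sum_range_zero, finiteConvolution]
      have h1 := Measure.map_const P (0 : ι → ℝ)
      rw [measure_univ, one_smul] at h1
      exact h1.symm
    | succ n ih =>
      rw [Finset.sum_range_succ, (hind.indepFun_finsetSum_of_notMem hmeas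
        Finset.notMem_range_self).map_add_eq_map_conv_map
        (hSn n) (hmeas n), finiteConvolution, ih,
        show P.map (fun x : ℕ → ι → ℝ => x n) = _ from Measure.infinitePi_map_eval _ n]
  have hae : ∀ᵐ x ∂P, ∀ n, x n ∈ D n := by
    rw [ae_all_iff]
    intro n
    have h1 := ae_mem_uniformMeasure (D n)
    rw [← Measure.infinitePi_map_eval (fun n => uniformMeasure (D n)) n] at h1
    exact ae_of_ae_map (hmeas n).aemeasurable h1
  have hlim : ∀ᵐ x ∂P, Tendsto (fun n => ∑ k ∈ Finset.range n, x k) atTop (𝓝 (∑' k, x k)) := by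
    filter_upwards [hae] with x hx
    exact (Summable.of_norm_bounded hc fun n => hb n _ (hx n)).hasSum.tendsto_sum_nat
  have hSm : AEMeasurable (fun x : ℕ → ι → ℝ => ∑' k, x k) P :=
    aemeasurable_of_tendsto_metrizable_ae atTop
      (fun n => (Finset.measurable_sum (Finset.range n) fun k _ => hmeas k).aemeasurable) hlim
  refine ⟨P.map fun x => ∑' k, x k, Measure.isProbabilityMeasure_map hSm, fun f => ?_⟩
  rw [integral_map hSm f.continuous.measurable.aestronglyMeasurable]
  have h3 : ∀ n, ∫ x, f x ∂(finiteConvolution (fun n => uniformMeasure (D n)) n) =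
      ∫ x, f (∑ k ∈ Finset.range n, x k) ∂P := by
    intro n
    rw [hlaw, integral_map (hSn n).aemeasurable
      f.continuous.measurable.aestronglyMeasurable]
    simp only [Finset.sum_apply]
  simp_rw [h3]
  refine tendsto_integral_of_dominated_convergence (fun _ => ‖f‖) (fun n => ?_)
    (integrable_const _) (fun n => ?_) ?_
  · exact (f.continuous.measurable.comp
      (Finset.measurable_sum (Finset.range n) fun k _ => hmeas k)).aestronglyMeasurable
  · exact ae_of_all _ fun x => f.norm_coe_le_norm _
  · filter_upwards [hlim] with x hx
    exact (f.continuous.tendsto _).comp hx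

/-- The infinite convolution defining `randomConvolution` exists for every word over a finite
alphabet. -/
lemma isInfiniteConvolution_randomConvolution {κ : Type*} [Finite κ] {R : Matrix ι ι ℤ}
    (hR : IsExpansive R) {B : κ → Finset (ι → ℤ)} (hB : ∀ i, (B i).Nonempty) (ω : ℕ → κ) :
    IsInfiniteConvolution (fun n => uniformMeasure (scaledDigits R (n + 1) (B (ω n))))
      (randomConvolution R B ω) := by
  apply isInfiniteConvolution_infiniteConvolution
  cases nonempty_fintype κ
  let K : ℝ := ∑ i, ∑ b ∈ B i, ‖realVec b‖
  have hK : ∀ i, ∀ b ∈ B i, ‖realVec b‖ ≤ K := by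
    intro i b hb
    refine (Finset.single_le_sum (f := fun b => ‖realVec b‖) (fun _ _ => norm_nonneg _) hb).trans ?_
    exact Finset.single_le_sum (f := fun i => ∑ b ∈ B i, ‖realVec b‖)
      (fun _ _ => Finset.sum_nonneg fun _ _ => norm_nonneg _) (Finset.mem_univ i)
  refine exists_isInfiniteConvolution (c := fun n => ‖realInv R ^ (n + 1)‖ * K)
    (fun n => (hB _).image _)
    (((summable_nat_add_iff 1).2 (summable_norm_realInv_pow hR)).mul_right K) ?_
  intro n x hx
  obtain ⟨b, hb, rfl⟩ := Finset.mem_image.1 hx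
  exact (Matrix.linfty_opNorm_mulVec _ _).trans
    (mul_le_mul_of_nonneg_left (hK _ _ hb) (norm_nonneg _))

/-- The infinite convolution defining `selfAffineMeasure` exists. -/
lemma isInfiniteConvolution_selfAffineMeasure {R : Matrix ι ι ℤ}
    (hR : IsExpansive R) {B : Finset (ι → ℤ)} (hB : B.Nonempty) :
    IsInfiniteConvolution (fun n => uniformMeasure (scaledDigits R (n + 1) B))
      (selfAffineMeasure R B) :=
  isInfiniteConvolution_randomConvolution (κ := Unit) hR (B := fun _ => B) (fun _ => hB)
    fun _ => ()

end WellDefined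

/-- The matrix of a quasi-product form is expansive, so that its self-affine measure exists. -/
lemma IsQuasiProductForm.isExpansive {r d N : ℕ}
    {bigR : Matrix (Fin r ⊕ Fin d) (Fin r ⊕ Fin d) ℤ} {bigB bigL : Finset (Fin r ⊕ Fin d → ℤ)}
    {R₁ : Matrix (Fin r) (Fin r) ℤ} {a : Fin N → Fin r → ℤ} {L₁ : Finset (Fin r → ℤ)}
    {R : Matrix (Fin d) (Fin d) ℤ} {B : Fin N → Finset (Fin d → ℤ)} {L : Finset (Fin d → ℤ)}
    (h : IsQuasiProductForm bigR bigB bigL R₁ a L₁ R B L) : IsExpansive bigR := by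
  obtain ⟨C, rfl⟩ := h.matrix_eq
  obtain ⟨i, -⟩ := Finset.mem_image.1 h.hadamard_first.zero_mem_digits
  intro z hz
  have h0 : (0 : Matrix (Fin r) (Fin d) ℤ).map (Int.cast : ℤ → ℂ) = 0 := by
    ext; simp
  rw [Matrix.fromBlocks_map, h0, Matrix.mem_spectrum_iff_isRoot_charpoly,
    Matrix.charpoly_fromBlocks_zero₁₂, Polynomial.root_mul,
    ← Matrix.mem_spectrum_iff_isRoot_charpoly, ← Matrix.mem_spectrum_iff_isRoot_charpoly] at hz
  exact hz.elim (h.hadamard_first.expansive z) ((h.hadamard i).expansive z)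

end QuasiProduct

end

/-! A point distributed by the measure of the big system arises by drawing a word `ω`, taking the
coded point `X(ω)` of the digits `(a i, 0)`, and adding `(0, y)` with `y` drawn from `μ_ω`. On the
Fourier side this is `fourier_selfAffineMeasure`. As the big matrix is block triangular, the first
component of `X(ω)` is the coded point `x(ω)` of the system `(R₁, a)`, whose law is `μ₁`; the block
`C` affects only the second component.

The key fact is that `ω` is almost surely determined by `x(ω)` (`exists_ae_eq_comp_coding`). The
Hadamard condition makes the `a i` incongruent modulo `R₁ ℤʳ`. This bounds the number of times a
shift orbit meets the words whose point has a second code with another first letter, so Poincaré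
recurrence makes these words negligible (`wordMeasure_overlap`). For fixed `η`, the transform of
`μ_ω` at `η`, times the phase coming from the second component of `X(ω)`, is therefore a function in
`L²(μ₁)`. Parseval for `Λ₁` sums the squared transforms over `Λ₁` to the mean of `|μ̂_ω(η)|²`, the
phase dropping out (`tsum_enorm_fourier_sq`). Summing over `Λ₂` gives `spectralSum_prodSet`: with `Q
= ∑ |μ̂(· - λ)|²`, the `Q` of the product set at `(ξ, η)` is the mean of `Q_ω(η)`.

A countable set is a spectrum exactly when `Q = 1` everywhere, so one direction follows by
averaging. Conversely, all means are `1`. At `η ∈ Λ₂` the diagonal term forces `Q_ω(η) ≥ 1`, hence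
equality almost surely; this is orthonormality, and Bessel then gives `Q_ω ≤ 1` everywhere. Equality
of means now yields `Q_ω = 1` almost surely on a countable dense set, which suffices by
`isSpectrum_of_spectralSum`. -/

namespace QuasiProduct

open scoped ComplexConjugate

/-! ### Exponentials and uniqueness of Fourier transforms -/

section FourierTransform

variable {ι : Type*} [Fintype ι]

lemma continuous_expo_uncurry : Continuous fun p : (ι → ℝ) × (ι → ℝ) => expo p.1 p.2 := by
  unfold expo dotProduct
  fun_prop

@[fun_prop]
lemma continuous_expo (ξ : ι → ℝ) : Continuous (expo ξ) :=
  continuous_expo_uncurry.comp (Continuous.prodMk_right ξ)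

lemma continuous_expo_left (x : ι → ℝ) : Continuous fun ξ => expo ξ x :=
  continuous_expo_uncurry.comp (Continuous.prodMk_left x)

@[simp]
lemma norm_expo (ξ x : ι → ℝ) : ‖expo ξ x‖ = 1 := by
  rw [expo, show 2 * (Real.pi : ℂ) * Complex.I * ((ξ ⬝ᵥ x : ℝ) : ℂ)
    = ((2 * Real.pi * (ξ ⬝ᵥ x) : ℝ) : ℂ) * Complex.I by push_cast; ring]
  exact Complex.norm_exp_ofReal_mul_I _

lemma expo_add_left (ξ η x : ι → ℝ) : expo (ξ + η) x = expo ξ x * expo η x := by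
  simp only [expo, add_dotProduct, ← Complex.exp_add]
  push_cast; ring_nf

lemma expo_add_right (ξ x y : ι → ℝ) : expo ξ (x + y) = expo ξ x * expo ξ y := by
  simp only [expo, dotProduct_add, ← Complex.exp_add]
  push_cast; ring_nf

@[simp]
lemma expo_zero_left (x : ι → ℝ) : expo 0 x = 1 := by simp [expo]

@[simp]
lemma expo_zero_right (ξ : ι → ℝ) : expo ξ 0 = 1 := by simp [expo]

lemma expo_neg_left (ξ x : ι → ℝ) : expo (-ξ) x = conj (expo ξ x) := by
  simp only [expo, neg_dotProduct, ← Complex.exp_conj, map_mul, Complex.conj_ofReal,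
    Complex.conj_I, map_ofNat]
  push_cast; ring_nf

/-- The Fourier transform of a measure. -/
noncomputable def fourier (μ : Measure (ι → ℝ)) (ξ : ι → ℝ) : ℂ := ∫ x, expo ξ x ∂μ

lemma integrable_expo (μ : Measure (ι → ℝ)) [IsFiniteMeasure μ] (ξ : ι → ℝ) :
    Integrable (expo ξ) μ :=
  Integrable.of_bound (continuous_expo ξ).measurable.aestronglyMeasurable 1
    (ae_of_all _ fun x => (norm_expo ξ x).le)

@[simp]
lemma fourier_zero (μ : Measure (ι → ℝ)) [IsProbabilityMeasure μ] : fourier μ 0 = 1 := by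
  simp [fourier]

/-- A finite measure is determined by its Fourier transform. -/
lemma ext_of_fourier {μ ν : Measure (ι → ℝ)} [IsFiniteMeasure μ] [IsFiniteMeasure ν]
    (h : ∀ ξ, fourier μ ξ = fourier ν ξ) : μ = ν := by
  refine ext_of_integral_char_eq (L := dotProductBilin ℝ ℝ) Real.continuous_fourierChar
    (fun h1 => ?_) (fun v hv h0 => hv ?_) ?_ fun w => ?_
  -- The standard character is nontrivial: it takes the value `-1` at `1/2`.
  · have h2 := DFunLike.congr_fun h1 (1 / 2 : ℝ)
    have h3 := congrArg (fun z : Circle => (z : ℂ)) h2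
    simp only [Real.fourierChar_apply, AddChar.one_apply, Circle.coe_one] at h3
    rw [show ((2 * Real.pi * (1 / 2) : ℝ) : ℂ) * Complex.I = Real.pi * Complex.I by
      push_cast; ring, Complex.exp_pi_mul_I] at h3
    norm_num at h3
  · have := LinearMap.congr_fun h0 v
    exact dotProduct_self_eq_zero.1 this
  · change Continuous fun p : (ι → ℝ) × (ι → ℝ) => p.1 ⬝ᵥ p.2
    unfold dotProduct
    fun_prop
  · have key : ∀ v, BoundedContinuousFunction.char Real.continuous_fourierChar
        (show Continuous fun p : (ι → ℝ) × (ι → ℝ) => dotProductBilin ℝ ℝ p.1 p.2 by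
          change Continuous fun p : (ι → ℝ) × (ι → ℝ) => p.1 ⬝ᵥ p.2
          unfold dotProduct
          fun_prop) w v = expo w v := by
      intro v
      rw [BoundedContinuousFunction.char_apply]
      change ((Real.fourierChar (v ⬝ᵥ w) : Circle) : ℂ) = _
      rw [Real.fourierChar_apply, expo, dotProduct_comm]
      push_cast; ring_nf
    simp_rw [key]
    exact h w

/-- The positive and negative parts of `g` are densities of two finite measures with equal Fourier
transforms; the measures coincide, hence so do the parts. -/
lemma ae_eq_zero_of_fourier_eq_zero_real {μ : Measure (ι → ℝ)} [IsFiniteMeasure μ]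
    {g : (ι → ℝ) → ℝ} (hg : Integrable g μ) (h : ∀ ξ, ∫ x, expo ξ x * (g x : ℂ) ∂μ = 0) :
    g =ᵐ[μ] 0 := by
  have hfin : ∀ {g : (ι → ℝ) → ℝ}, Integrable g μ →
      IsFiniteMeasure (μ.withDensity fun x => ENNReal.ofReal (g x)) := fun {g} hg =>
    isFiniteMeasure_withDensity_ofReal hg.2
  have := hfin hg
  have := hfin hg.neg
  have hF : ∀ {g : (ι → ℝ) → ℝ}, Integrable g μ → ∀ ξ,
      fourier (μ.withDensity fun x => ENNReal.ofReal (g x)) ξ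
        = ∫ x, expo ξ x * ((max (g x) 0 : ℝ) : ℂ) ∂μ := by
    intro g hg ξ
    rw [fourier, integral_withDensity_eq_integral_toReal_smul₀
      hg.aemeasurable.ennreal_ofReal (ae_of_all _ fun _ => ENNReal.ofReal_lt_top)]
    refine integral_congr_ae (ae_of_all _ fun x => ?_)
    simp only [ENNReal.toReal_ofReal', Complex.real_smul, mul_comm]
  have hint : ∀ {g : (ι → ℝ) → ℝ}, Integrable g μ → ∀ ξ,
      Integrable (fun x => expo ξ x * ((max (g x) 0 : ℝ) : ℂ)) μ := by
    intro g hg ξ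
    exact hg.pos_part.ofReal.bdd_mul (c := 1)
      (continuous_expo ξ).measurable.aestronglyMeasurable
      (ae_of_all _ fun x => (norm_expo ξ x).le)
  have heq := ext_of_fourier (μ := μ.withDensity fun x => ENNReal.ofReal (g x))
    (ν := μ.withDensity fun x => ENNReal.ofReal ((-g) x)) fun ξ => by
      rw [hF hg, hF hg.neg, ← sub_eq_zero, ← integral_sub (hint hg ξ) (hint hg.neg ξ), ← h ξ]
      refine integral_congr_ae (ae_of_all _ fun x => ?_)
      simp only [Pi.neg_apply]
      rw [← mul_sub, ← Complex.ofReal_sub]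
      congr 2
      rcases le_total (g x) 0 with h0 | h0
      · rw [max_eq_right h0, max_eq_left (by linarith)]; ring
      · rw [max_eq_left h0, max_eq_right (by linarith)]; ring
  rw [withDensity_eq_iff hg.aemeasurable.ennreal_ofReal hg.neg.aemeasurable.ennreal_ofReal
    hg.lintegral_lt_top.ne] at heq
  filter_upwards [heq] with x hx
  simp only [Pi.neg_apply] at hx
  rcases le_total (g x) 0 with h0 | h0
  · rw [ENNReal.ofReal_of_nonpos h0, eq_comm, ENNReal.ofReal_eq_zero] at hx
    simp only [Pi.zero_apply]; linarith
  · rw [ENNReal.ofReal_of_nonpos (p := -g x) (by linarith), ENNReal.ofReal_eq_zero] at hx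
    simp only [Pi.zero_apply]; linarith

/-- An integrable function is zero if it is orthogonal to all exponentials. -/
lemma ae_eq_zero_of_fourier_eq_zero {μ : Measure (ι → ℝ)} [IsFiniteMeasure μ]
    {f : (ι → ℝ) → ℂ} (hf : Integrable f μ) (h : ∀ ξ, ∫ x, expo ξ x * f x ∂μ = 0) :
    f =ᵐ[μ] 0 := by
  have hb : ∀ {g : (ι → ℝ) → ℂ}, Integrable g μ → ∀ ξ, Integrable (fun x => expo ξ x * g x) μ :=
    fun hg ξ => hg.bdd_mul (c := 1) (continuous_expo ξ).measurable.aestronglyMeasurable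
      (ae_of_all _ fun x => (norm_expo ξ x).le)
  -- The hypothesis is invariant under conjugation, up to the sign of the frequency, so the real and
  -- imaginary parts inherit it.
  have hc : ∀ ξ, ∫ x, expo ξ x * conj (f x) ∂μ = 0 := by
    intro ξ
    rw [← map_zero (starRingEnd ℂ), ← h (-ξ), ← integral_conj]
    simp only [map_mul, expo_neg_left, Complex.conj_conj]
  have hfc : Integrable (fun x => conj (f x)) μ := Complex.conjLIE.integrable_comp_iff.2 hf
  have hre : (fun x => (f x).re) =ᵐ[μ] 0 := by
    refine ae_eq_zero_of_fourier_eq_zero_real hf.re fun ξ => ?_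
    have := integral_add (hb hf ξ) (hb hfc ξ)
    rw [h, hc, add_zero] at this
    have h2 : (fun x => expo ξ x * f x + expo ξ x * conj (f x))
        = fun x => 2 * (expo ξ x * ((f x).re : ℂ)) := by
      funext x
      rw [← mul_add, Complex.add_conj]; push_cast; ring
    rw [h2, integral_const_mul] at this
    simpa using this
  have him : (fun x => (f x).im) =ᵐ[μ] 0 := by
    refine ae_eq_zero_of_fourier_eq_zero_real hf.im fun ξ => ?_
    have := integral_sub (hb hf ξ) (hb hfc ξ)
    rw [h, hc, sub_zero] at this
    have h2 : (fun x => expo ξ x * f x - expo ξ x * conj (f x))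
        = fun x => (2 * Complex.I) * (expo ξ x * ((f x).im : ℂ)) := by
      funext x
      rw [← mul_sub, Complex.sub_conj]; push_cast; ring
    rw [h2, integral_const_mul] at this
    simpa using this
  filter_upwards [hre, him] with x h1 h2
  exact Complex.ext h1 h2

end FourierTransform

/-! ### Parseval sums and the spectrum criterion -/

section SpectrumCriterion

variable {ι : Type*} [Fintype ι]

lemma memLp_expo (μ : Measure (ι → ℝ)) [IsFiniteMeasure μ] (ξ : ι → ℝ) : MemLp (expo ξ) 2 μ :=
  MemLp.of_bound (continuous_expo ξ).measurable.aestronglyMeasurable 1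
    (ae_of_all _ fun x => (norm_expo ξ x).le)

/-- The exponential with frequency `ξ` as an element of `L²(μ)`. -/
noncomputable def expoLp (μ : Measure (ι → ℝ)) [IsFiniteMeasure μ] (ξ : ι → ℝ) : Lp ℂ 2 μ :=
  (memLp_expo μ ξ).toLp

lemma inner_expoLp_toLp {μ : Measure (ι → ℝ)} [IsFiniteMeasure μ] (ξ : ι → ℝ)
    {f : (ι → ℝ) → ℂ} (hf : MemLp f 2 μ) :
    inner ℂ (expoLp μ ξ) hf.toLp = ∫ x, expo (-ξ) x * f x ∂μ := by
  rw [L2.inner_def]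
  refine integral_congr_ae ?_
  filter_upwards [(memLp_expo μ ξ).coeFn_toLp, hf.coeFn_toLp] with x h1 h2
  rw [expoLp, h1, h2, expo_neg_left, RCLike.inner_apply, mul_comm]

lemma inner_expoLp {μ : Measure (ι → ℝ)} [IsFiniteMeasure μ] (ξ η : ι → ℝ) :
    inner ℂ (expoLp μ ξ) (expoLp μ η) = fourier μ (η - ξ) := by
  rw [expoLp, expoLp, ← expoLp, inner_expoLp_toLp, fourier]
  refine integral_congr_ae (ae_of_all _ fun x => ?_)
  simp only [sub_eq_neg_add, expo_add_left]

@[simp]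
lemma norm_expoLp (μ : Measure (ι → ℝ)) [IsProbabilityMeasure μ] (ξ : ι → ℝ) :
    ‖expoLp μ ξ‖ = 1 := by
  have h := inner_self_eq_norm_sq_to_K (𝕜 := ℂ) (expoLp μ ξ)
  rw [inner_expoLp, sub_self, fourier_zero] at h
  have h2 : ‖expoLp μ ξ‖ ^ 2 = 1 := by
    refine Complex.ofReal_injective ?_
    simpa using h.symm
  exact (pow_eq_one_iff_of_nonneg (norm_nonneg _) two_ne_zero).1 h2

lemma hasSum_norm_inner_sq {κ H : Type*} [NormedAddCommGroup H] [InnerProductSpace ℂ H]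
    (b : HilbertBasis κ ℂ H) (v : H) : HasSum (fun i => ‖inner ℂ (b i) v‖ ^ 2) (‖v‖ ^ 2) := by
  have h := Complex.hasSum_re (b.hasSum_inner_mul_inner v v)
  rw [inner_self_eq_norm_sq_to_K] at h
  convert h using 1
  · funext i
    rw [← inner_conj_symm v (b i), RCLike.conj_mul]
    norm_cast
  · norm_cast

/-- Parseval's identity for a measure with a spectrum. -/
lemma IsSpectrum.tsum_enorm_integral_sq {μ : Measure (ι → ℝ)} [IsFiniteMeasure μ]
    {Λ : Set (ι → ℝ)} (h : IsSpectrum μ Λ) {f : (ι → ℝ) → ℂ} (hf : MemLp f 2 μ) :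
    ∑' l : Λ, ‖∫ x, expo (-(l : ι → ℝ)) x * f x ∂μ‖ₑ ^ 2 = ∫⁻ x, ‖f x‖ₑ ^ 2 ∂μ := by
  obtain ⟨-, b, hb⟩ := h
  have hbe : ∀ l : Λ, b l = expoLp μ l := fun l =>
    Lp.ext ((hb l).trans (memLp_expo μ l).coeFn_toLp.symm)
  have h1 := hasSum_norm_inner_sq b hf.toLp
  simp only [hbe, inner_expoLp_toLp] at h1
  have h2 := ENNReal.ofReal_tsum_of_nonneg (fun _ => by positivity) h1.summable
  rw [h1.tsum_eq] at h2
  have h3 : ∀ z : ℂ, ENNReal.ofReal (‖z‖ ^ 2) = ‖z‖ₑ ^ 2 := fun z => by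
    rw [ENNReal.ofReal_pow (norm_nonneg _), ofReal_norm]
  simp only [h3] at h2
  rw [← h2, Lp.norm_toLp, ENNReal.ofReal_pow ENNReal.toReal_nonneg,
    ENNReal.ofReal_toReal hf.2.ne, eLpNorm_eq_lintegral_rpow_enorm_toReal (by norm_num) (by norm_num),
    ← ENNReal.rpow_natCast, ← ENNReal.rpow_mul]
  simp

/-- The sum `∑_{λ ∈ Λ} |μ̂(ξ - λ)|²`. -/
noncomputable def spectralSum (μ : Measure (ι → ℝ)) (Λ : Set (ι → ℝ)) (ξ : ι → ℝ) : ℝ≥0∞ :=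
  ∑' l : Λ, ‖fourier μ (ξ - l)‖ₑ ^ 2

/-- Parseval applied to the unimodular function `expo ξ`. -/
lemma IsSpectrum.spectralSum_eq_one {μ : Measure (ι → ℝ)} [IsProbabilityMeasure μ]
    {Λ : Set (ι → ℝ)} (h : IsSpectrum μ Λ) (ξ : ι → ℝ) : spectralSum μ Λ ξ = 1 := by
  have h1 := h.tsum_enorm_integral_sq (memLp_expo μ ξ)
  have h2 : ∀ x, ‖expo ξ x‖ₑ = 1 := fun x => by
    rw [← ofReal_norm, norm_expo, ENNReal.ofReal_one]
  simp only [h2, one_pow, lintegral_one, measure_univ] at h1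
  rw [← h1, spectralSum]
  congr! 3
  simp only [fourier, sub_eq_neg_add, expo_add_left]

lemma one_le_spectralSum {μ : Measure (ι → ℝ)} [IsProbabilityMeasure μ]
    {Λ : Set (ι → ℝ)} {ξ : ι → ℝ} (hξ : ξ ∈ Λ) : 1 ≤ spectralSum μ Λ ξ := by
  refine le_trans ?_ (ENNReal.le_tsum (⟨ξ, hξ⟩ : Λ))
  simp

/-- At a point of `Λ` the diagonal term alone contributes `1`, so every other term, a squared inner
product, must vanish. -/
lemma orthonormal_expoLp {μ : Measure (ι → ℝ)} [IsProbabilityMeasure μ] {Λ : Set (ι → ℝ)}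
    (h : ∀ ξ ∈ Λ, spectralSum μ Λ ξ = 1) : Orthonormal ℂ fun l : Λ => expoLp μ l := by
  refine ⟨fun l => norm_expoLp μ l, fun k l hkl => ?_⟩
  change inner ℂ (expoLp μ k) (expoLp μ l) = 0
  rw [inner_expoLp]
  have h1 := h l l.2
  have h2 := ENNReal.sum_le_tsum (f := fun k : Λ => ‖fourier μ ((l : ι → ℝ) - k)‖ₑ ^ 2) {l, k}
  rw [← spectralSum, h1, Finset.sum_pair hkl.symm] at h2
  simp only [sub_self, fourier_zero, enorm_one, one_pow] at h2
  have h3 : ‖fourier μ ((l : ι → ℝ) - k)‖ₑ ^ 2 ≤ 0 := by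
    refine (ENNReal.add_le_add_iff_left ENNReal.one_ne_top).1 ?_
    simpa using h2
  simpa using h3

/-- Bessel's inequality for the unit vector `expoLp μ ξ`; orthonormality only needs the values of
the sum on `Λ`. -/
lemma spectralSum_le_one {μ : Measure (ι → ℝ)} [IsProbabilityMeasure μ] {Λ : Set (ι → ℝ)}
    (h : ∀ ξ ∈ Λ, spectralSum μ Λ ξ = 1) (ξ : ι → ℝ) : spectralSum μ Λ ξ ≤ 1 := by
  rw [spectralSum, ENNReal.tsum_eq_iSup_sum]
  refine iSup_le fun s => ?_
  have h1 := (orthonormal_expoLp h).sum_inner_products_le (s := s) (expoLp μ ξ)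
  simp only [inner_expoLp, norm_expoLp, one_pow] at h1
  calc ∑ l ∈ s, ‖fourier μ (ξ - l)‖ₑ ^ 2
      = ENNReal.ofReal (∑ l ∈ s, ‖fourier μ (ξ - l)‖ ^ 2) := by
        rw [ENNReal.ofReal_sum_of_nonneg fun _ _ => by positivity]
        refine Finset.sum_congr rfl fun l _ => ?_
        rw [ENNReal.ofReal_pow (norm_nonneg _), ofReal_norm]
    _ ≤ 1 := by simpa using ENNReal.ofReal_le_ofReal h1

/-- The criterion of Jorgensen and Pedersen, on a dense set of test frequencies. -/
lemma isSpectrum_of_spectralSum {μ : Measure (ι → ℝ)} [IsProbabilityMeasure μ] {Λ : Set (ι → ℝ)}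
    (hΛ : Λ.Countable) (h : ∀ ξ ∈ Λ, spectralSum μ Λ ξ = 1) {D : Set (ι → ℝ)} (hD : Dense D)
    (h' : ∀ ξ ∈ D, spectralSum μ Λ ξ = 1) : IsSpectrum μ Λ := by
  have ho := orthonormal_expoLp h
  set V := (Submodule.span ℂ (Set.range fun l : Λ => expoLp μ l)).topologicalClosure with hV
  have hmem : ∀ ξ ∈ D, expoLp μ ξ ∈ V := by
    intro ξ hξ
    have h1 := h' ξ hξ
    have hsum : HasSum (fun l : Λ => ‖fourier μ (ξ - l)‖ ^ 2) 1 := by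
      have h3 : ∀ l : Λ, ‖fourier μ (ξ - l)‖ₑ ^ 2
          = ENNReal.ofReal (‖fourier μ (ξ - l)‖ ^ 2) := fun l => by
        rw [ENNReal.ofReal_pow (norm_nonneg _), ofReal_norm]
      rw [spectralSum] at h1
      have hs := ENNReal.summable.hasSum_iff.2 h1
      simp only [h3] at hs
      have := ENNReal.hasSum_toReal (f := fun l : Λ =>
        ENNReal.ofReal (‖fourier μ (ξ - l)‖ ^ 2)) (by rw [hs.tsum_eq]; simp)
      rw [← ENNReal.tsum_toReal_eq (fun _ => ENNReal.ofReal_ne_top), hs.tsum_eq] at this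
      simpa using this
    have hlim : Tendsto (fun s : Finset Λ =>
        ∑ l ∈ s, fourier μ (ξ - l) • expoLp μ l) atTop (𝓝 (expoLp μ ξ)) := by
      rw [tendsto_iff_norm_sub_tendsto_zero]
      -- Pythagoras: the coefficients are the inner products of `expoLp μ ξ` with the orthonormal
      -- family.
      have hn : ∀ s : Finset Λ, ‖∑ l ∈ s, fourier μ (ξ - l) • expoLp μ l - expoLp μ ξ‖ ^ 2
          = 1 - ∑ l ∈ s, ‖fourier μ (ξ - l)‖ ^ 2 := by
        intro s
        refine Complex.ofReal_injective ?_
        have h0 := inner_self_eq_norm_sq_to_K (𝕜 := ℂ)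
          (∑ l ∈ s, fourier μ (ξ - l) • expoLp μ l - expoLp μ ξ)
        rw [inner_sub_left, inner_sub_right, inner_sub_right, ho.inner_sum, sum_inner, inner_sum,
          inner_self_eq_norm_sq_to_K, norm_expoLp] at h0
        simp only [inner_smul_left, inner_smul_right, inner_expoLp, RCLike.conj_mul] at h0
        have h5 : ∀ l : Λ, fourier μ (ξ - l) * fourier μ (l - ξ)
            = (‖fourier μ (ξ - l)‖ : ℂ) ^ 2 := fun l => by
          rw [← inner_expoLp, ← inner_expoLp, ← inner_conj_symm (expoLp μ ξ), RCLike.mul_conj]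
          rfl
        simp only [h5] at h0
        rw [Complex.ofReal_pow]
        refine Eq.trans h0.symm ?_
        push_cast
        ring
      have h4 : Tendsto (fun s : Finset Λ =>
          ‖∑ l ∈ s, fourier μ (ξ - l) • expoLp μ l - expoLp μ ξ‖ ^ 2) atTop (𝓝 0) := by
        simp only [hn]
        simpa using hsum.const_sub 1
      have h5 := h4.sqrt
      simpa [Real.sqrt_sq] using h5
    refine mem_closure_of_tendsto hlim (Eventually.of_forall fun s => ?_)
    exact Submodule.sum_mem _ fun l _ =>
      Submodule.smul_mem _ _ (Submodule.subset_span ⟨l, rfl⟩)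
  have hbot : (Submodule.span ℂ (Set.range fun l : Λ => expoLp μ l))ᗮ = ⊥ := by
    rw [← Submodule.orthogonal_closure, ← hV, Submodule.eq_bot_iff]
    intro f hf
    have hf0 : ∀ ξ ∈ D, ∫ x, expo (-ξ) x * f x ∂μ = 0 := by
      intro ξ hξ
      have h1 := Submodule.inner_right_of_mem_orthogonal (hmem ξ hξ) hf
      rwa [← Lp.toLp_coeFn f (Lp.memLp f), inner_expoLp_toLp] at h1
    have hfi : Integrable f μ := (Lp.memLp f).integrable (by norm_num)
    -- Continuity carries the vanishing from the dense set `D` to all frequencies.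
    have hcont : Continuous fun ξ : ι → ℝ => ∫ x, expo (-ξ) x * f x ∂μ := by
      refine continuous_of_dominated (bound := fun x => ‖f x‖) (fun ξ => ?_)
        (fun ξ => ae_of_all _ fun x => by simp) hfi.norm (ae_of_all _ fun x => ?_)
      · exact (continuous_expo _).measurable.aestronglyMeasurable.mul hfi.1
      · exact ((continuous_expo_left x).comp continuous_neg).mul continuous_const
    have hall := hcont.ext_on hD continuous_zero hf0
    have := ae_eq_zero_of_fourier_eq_zero hfi fun ξ => by
      simpa using congrFun hall (-ξ)
    exact (Lp.eq_zero_iff_ae_eq_zero).2 this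
  refine ⟨hΛ, HilbertBasis.mkOfOrthogonalEqBot ho hbot, fun l => ?_⟩
  rw [HilbertBasis.coe_mkOfOrthogonalEqBot]
  exact (memLp_expo μ l).coeFn_toLp

end SpectrumCriterion

/-! ### Integer matrices and incongruent digits -/

section Matrices

variable {ι : Type*} [Fintype ι] [DecidableEq ι]

/-- An integer matrix as a real matrix. -/
def realMat (R : Matrix ι ι ℤ) : Matrix ι ι ℝ := R.map (Int.cast : ℤ → ℝ)

omit [Fintype ι] [DecidableEq ι] in
lemma realVec_injective : Function.Injective (realVec : (ι → ℤ) → ι → ℝ) := fun b c h => by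
  funext i
  have : (b i : ℝ) = c i := congrFun h i
  exact_mod_cast this

omit [Fintype ι] [DecidableEq ι] in
lemma realVec_add (b c : ι → ℤ) : realVec (b + c) = realVec b + realVec c := by
  funext i; simp [realVec]

omit [Fintype ι] [DecidableEq ι] in
lemma realVec_sub (b c : ι → ℤ) : realVec (b - c) = realVec b - realVec c := by
  funext i; simp [realVec]

omit [DecidableEq ι] in
lemma realVec_mulVec (R : Matrix ι ι ℤ) (b : ι → ℤ) :
    realVec (R *ᵥ b) = realMat R *ᵥ realVec b := by
  funext i; simp [realVec, realMat, Matrix.mulVec, dotProduct]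

lemma isUnit_det_realMat {R : Matrix ι ι ℤ} (hR : IsExpansive R) : IsUnit (realMat R).det := by
  obtain ⟨hu, -⟩ := realInv_map hR
  rw [Matrix.isUnit_iff_isUnit_det] at hu
  have h1 := (Int.castRingHom ℂ).map_det R
  have h2 := (Int.castRingHom ℝ).map_det R
  rw [isUnit_iff_ne_zero] at hu ⊢
  have h3 : (realMat R).det = (R.det : ℝ) := h2.symm
  have h4 : (R.map (Int.cast : ℤ → ℂ)).det = (R.det : ℂ) := h1.symm
  rw [h3]
  rw [h4] at hu
  exact_mod_cast hu

lemma realMat_mul_realInv {R : Matrix ι ι ℤ} (hR : IsExpansive R) :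
    realMat R * realInv R = 1 := Matrix.mul_nonsing_inv _ (isUnit_det_realMat hR)

lemma realInv_mul_realMat {R : Matrix ι ι ℤ} (hR : IsExpansive R) :
    realInv R * realMat R = 1 := Matrix.nonsing_inv_mul _ (isUnit_det_realMat hR)

lemma mulVec_realMat_pow_injective {R : Matrix ι ι ℤ} (hR : IsExpansive R) (n : ℕ) :
    Function.Injective fun x : ι → ℝ => realMat R ^ n *ᵥ x := by
  apply Matrix.mulVec_injective_of_isUnit
  exact ((Matrix.isUnit_iff_isUnit_det _).2 (isUnit_det_realMat hR)).pow n

lemma mulVec_realInv_pow_injective {R : Matrix ι ι ℤ} (hR : IsExpansive R) (n : ℕ) :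
    Function.Injective fun x : ι → ℝ => realInv R ^ n *ᵥ x := by
  apply Matrix.mulVec_injective_of_isUnit
  exact (IsUnit.of_mul_eq_one _ (realInv_mul_realMat hR)).pow n

omit [DecidableEq ι] in
lemma expo_realVec_realVec (z l : ι → ℤ) : expo (realVec z) (realVec l) = 1 := by
  have h : (realVec z ⬝ᵥ realVec l : ℝ) = ((z ⬝ᵥ l : ℤ) : ℝ) := by
    simp [realVec, dotProduct]
  rw [expo, h, Complex.exp_eq_one_iff]
  exact ⟨z ⬝ᵥ l, by push_cast; ring⟩

/-- The digits of a Hadamard triple are pairwise incongruent modulo `R ℤⁿ`. -/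
lemma IsHadamardTriple.eq_of_sub_eq_mulVec {R : Matrix ι ι ℤ} {B L : Finset (ι → ℤ)}
    (h : IsHadamardTriple R B L) {b c : ι → ℤ} (hb : b ∈ B) (hc : c ∈ B) {z : ι → ℤ}
    (hz : b - c = R *ᵥ z) : b = c := by
  by_contra hbc
  -- Congruent digits shift `R⁻¹ b` by an integer vector, invisible to integer frequencies. Two
  -- equal columns contradict unitarity.
  have hcol : ∀ l, hadamardMatrix R B L l ⟨b, hb⟩ = hadamardMatrix R B L l ⟨c, hc⟩ := by
    intro l
    simp only [hadamardMatrix, Matrix.of_apply]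
    have h1 : realInv R *ᵥ realVec b = realInv R *ᵥ realVec c + realVec z := by
      rw [← sub_eq_iff_eq_add', ← Matrix.mulVec_sub, ← realVec_sub, hz, realVec_mulVec,
        Matrix.mulVec_mulVec, realInv_mul_realMat h.expansive, Matrix.one_mulVec]
    rw [h1, expo_add_left, expo_realVec_realVec, mul_one]
  have h0 := congrFun (congrFun h.unitary ⟨c, hc⟩) ⟨b, hb⟩
  have h1 := congrFun (congrFun h.unitary ⟨c, hc⟩) ⟨c, hc⟩
  rw [Matrix.mul_apply, Matrix.one_apply_ne (fun h => hbc (Subtype.ext_iff.1 h).symm)] at h0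
  rw [Matrix.mul_apply, Matrix.one_apply_eq] at h1
  simp only [hcol] at h0
  exact one_ne_zero (h1.symm.trans h0)

end Matrices

/-! ### Coded points and words with several codes -/

section Coding

variable {ι : Type*} [Fintype ι] [DecidableEq ι] {κ : Type*}

/-- The point `R⁻¹ a(ω₁) + R⁻² a(ω₂) + ⋯`. -/
noncomputable def coding (R : Matrix ι ι ℤ) (a : κ → ι → ℤ) (ω : ℕ → κ) : ι → ℝ :=
  ∑' k, realInv R ^ (k + 1) *ᵥ realVec (a (ω k))

/-- The left shift on words. -/
def shift (ω : ℕ → κ) : ℕ → κ := fun n => ω (n + 1)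

lemma iterate_shift (n : ℕ) (ω : ℕ → κ) (k : ℕ) : shift^[n] ω k = ω (k + n) := by
  induction n generalizing ω with
  | zero => rfl
  | succ n ih => rw [Function.iterate_succ_apply, ih, shift, add_assoc]

/-- One majorant serves all words, so it gives at once convergence, boundedness and continuity of
`coding`. -/
lemma exists_summable_bound [Finite κ] {R : Matrix ι ι ℤ} (hR : IsExpansive R)
    (a : κ → ι → ℤ) : ∃ c : ℕ → ℝ, Summable c ∧
      ∀ i k, ‖realInv R ^ (k + 1) *ᵥ realVec (a i)‖ ≤ c k := by
  let := Matrix.linftyOpNormedRing (α := ℝ) (n := ι)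
  cases nonempty_fintype κ
  refine ⟨fun k => ‖realInv R ^ (k + 1)‖ * ∑ i, ‖realVec (a i)‖,
    ((summable_nat_add_iff 1).2 (summable_norm_realInv_pow hR)).mul_right _, fun i k => ?_⟩
  refine (Matrix.linfty_opNorm_mulVec _ _).trans (mul_le_mul_of_nonneg_left ?_ (norm_nonneg _))
  exact Finset.single_le_sum (f := fun i => ‖realVec (a i)‖) (fun _ _ => norm_nonneg _)
    (Finset.mem_univ i)

variable [Finite κ] {R : Matrix ι ι ℤ} (hR : IsExpansive R) (a : κ → ι → ℤ)
include hR

lemma hasSum_coding (ω : ℕ → κ) :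
    HasSum (fun k => realInv R ^ (k + 1) *ᵥ realVec (a (ω k))) (coding R a ω) := by
  obtain ⟨c, hc, h⟩ := exists_summable_bound hR a
  exact (Summable.of_norm_bounded hc fun k => h _ k).hasSum

lemma exists_norm_coding_le : ∃ M, ∀ ω, ‖coding R a ω‖ ≤ M := by
  obtain ⟨c, hc, h⟩ := exists_summable_bound hR a
  exact ⟨∑' k, c k, fun ω => tsum_of_norm_bounded hc.hasSum fun k => h _ k⟩

lemma continuous_coding [TopologicalSpace κ] [DiscreteTopology κ] :
    Continuous (coding R a) := by
  obtain ⟨c, hc, h⟩ := exists_summable_bound hR a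
  refine continuous_tsum (fun k => ?_) hc fun k ω => h _ k
  exact (continuous_of_discreteTopology
    (f := fun i : κ => realInv R ^ (k + 1) *ᵥ realVec (a i))).comp (continuous_apply k)

lemma realMat_mulVec_coding (ω : ℕ → κ) :
    realMat R *ᵥ coding R a ω = realVec (a (ω 0)) + coding R a (shift ω) := by
  have h1 : coding R a ω = realInv R *ᵥ (realVec (a (ω 0)) + coding R a (shift ω)) := by
    rw [coding, (hasSum_coding hR a ω).summable.tsum_eq_zero_add, zero_add, pow_one,
      Matrix.mulVec_add]
    congr 1
    have h2 := (hasSum_coding hR a (shift ω)).map (Matrix.mulVecLin (realInv R))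
      (LinearMap.continuous_of_finiteDimensional _)
    rw [← Matrix.mulVecLin_apply, ← h2.tsum_eq]
    refine tsum_congr fun k => ?_
    simp only [Function.comp_apply, Matrix.mulVecLin_apply, Matrix.mulVec_mulVec, shift]
    rw [← pow_succ']
  rw [h1, Matrix.mulVec_mulVec, realMat_mul_realInv hR, Matrix.one_mulVec]

omit [Finite κ] hR [DecidableEq ι] in
/-- The integer vector `Rⁿ⁻¹ a(ω₁) + ⋯ + a(ωₙ)`. -/
def intPart (R : Matrix ι ι ℤ) (a : κ → ι → ℤ) (ω : ℕ → κ) : ℕ → ι → ℤ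
  | 0 => 0
  | n + 1 => R *ᵥ intPart R a ω n + a (ω n)

lemma realMat_pow_mulVec_coding (ω : ℕ → κ) (n : ℕ) :
    realMat R ^ n *ᵥ coding R a ω = realVec (intPart R a ω n) + coding R a (shift^[n] ω) := by
  induction n with
  | zero =>
    have : realVec (0 : ι → ℤ) = 0 := by funext i; simp [realVec]
    simp [intPart, this]
  | succ n ih =>
    rw [pow_succ', ← Matrix.mulVec_mulVec, ih, Matrix.mulVec_add, realMat_mulVec_coding hR,
      intPart, realVec_add, realVec_mulVec, Function.iterate_succ_apply', iterate_shift,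
      zero_add, add_assoc]

omit [Finite κ] hR [DecidableEq ι] in
lemma intPart_congr {ω ω' : ℕ → κ} {n : ℕ} (h : ∀ k < n, ω k = ω' k) :
    intPart R a ω n = intPart R a ω' n := by
  induction n with
  | zero => rfl
  | succ n ih => rw [intPart, intPart, ih fun k hk => h k (by omega), h n (by omega)]

omit [Finite κ] in
-- Reading off digits from the last one: it is determined modulo `R ℤⁿ`, and injectivity of `R` then
-- allows it to be stripped.
lemma eq_of_intPart_eq (ha : ∀ i j z, a i - a j = R *ᵥ z → i = j) {ω ω' : ℕ → κ} {n : ℕ}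
    (h : intPart R a ω n = intPart R a ω' n) : ∀ k < n, ω k = ω' k := by
  induction n with
  | zero => intro k hk; omega
  | succ n ih =>
    rw [intPart, intPart] at h
    have h1 : ω n = ω' n := by
      apply ha _ _ (intPart R a ω' n - intPart R a ω n)
      rw [Matrix.mulVec_sub, sub_eq_sub_iff_add_eq_add, add_comm, h, add_comm]
    rw [h1, add_left_inj] at h
    have h2 : intPart R a ω n = intPart R a ω' n := by
      apply realVec_injective
      have := congrArg realVec h
      rw [realVec_mulVec, realVec_mulVec] at this
      apply mulVec_realMat_pow_injective hR 1
      simpa using this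
    intro k hk
    rcases Nat.lt_succ_iff_lt_or_eq.1 hk with hk | rfl
    · exact ih h2 k hk
    · exact h1

omit [Finite κ] hR in
/-- The words whose coded point has another code with a different first letter. -/
def overlap (R : Matrix ι ι ℤ) (a : κ → ι → ℤ) : Set (ℕ → κ) :=
  {ω | ∃ ω', coding R a ω' = coding R a ω ∧ ω' 0 ≠ ω 0}

/-- Keeping the first `k` letters and replacing the tail by its other code does not move the coded
point. The visit time `k` becomes the first place where the two codes differ, so distinct visits
give distinct codes. -/
lemma exists_branch {ω : ℕ → κ} {k : ℕ} (h : shift^[k] ω ∈ overlap R a) :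
    ∃ w, coding R a w = coding R a ω ∧ (∀ j < k, w j = ω j) ∧ w k ≠ ω k := by
  obtain ⟨ω', h1, h2⟩ := h
  rw [iterate_shift, zero_add] at h2
  let w : ℕ → κ := fun j => if j < k then ω j else ω' (j - k)
  have hw : ∀ j < k, w j = ω j := fun j hj => if_pos hj
  refine ⟨w, mulVec_realMat_pow_injective hR k ?_, hw, by simpa [w] using h2⟩
  have hs : shift^[k] w = ω' := by
    funext j
    simp [iterate_shift, w]
  change realMat R ^ k *ᵥ _ = realMat R ^ k *ᵥ _
  rw [realMat_pow_mulVec_coding hR, realMat_pow_mulVec_coding hR, intPart_congr a hw, hs, h1]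

/-- If the digits are incongruent modulo `R ℤⁿ`, the orbit of a word visits the overlap set
boundedly often. -/
lemma exists_card_visits_le (ha : ∀ i j z, a i - a j = R *ᵥ z → i = j) :
    ∃ K, ∀ (ω : ℕ → κ) (s : Finset ℕ), (∀ k ∈ s, shift^[k] ω ∈ overlap R a) → s.card ≤ K := by
  obtain ⟨M, hM⟩ := exists_norm_coding_le hR a
  obtain ⟨m, hm⟩ := exists_nat_ge (2 * M)
  -- Two codes of one point have integer parts differing by a difference of two coded points, of
  -- norm at most `2M ≤ m`. The bound counts integer points in this box.
  refine ⟨(Finset.Icc (fun _ => -(m : ℤ)) (fun _ => (m : ℤ)) : Finset (ι → ℤ)).card,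
    fun ω s hs => ?_⟩
  have : Nonempty (ℕ → κ) := ⟨ω⟩
  choose! w hw1 hw2 hw3 using fun k (hk : k ∈ s) => exists_branch hR a (hs k hk)
  -- The level `n` lies beyond all visits in `s`, so the integer parts at level `n` see every
  -- branching letter.
  set n := s.sup id + 1 with hn
  have hlt : ∀ k ∈ s, k < n := fun k hk => Nat.lt_succ_of_le (Finset.le_sup (f := id) hk)
  refine Finset.card_le_card_of_injOn (fun k => intPart R a (w k) n - intPart R a ω n) ?_ ?_
  · intro k hk
    have hk' : k ∈ s := hk
    have h1 := realMat_pow_mulVec_coding hR a (w k) n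
    rw [hw1 k hk', realMat_pow_mulVec_coding hR] at h1
    have h2 : realVec (intPart R a (w k) n - intPart R a ω n)
        = coding R a (shift^[n] ω) - coding R a (shift^[n] (w k)) := by
      rw [realVec_sub, sub_eq_sub_iff_add_eq_add, ← h1, add_comm]
    have h3 : ‖realVec (intPart R a (w k) n - intPart R a ω n)‖ ≤ m := by
      rw [h2]
      refine (norm_sub_le _ _).trans (le_trans ?_ hm)
      linarith [hM (shift^[n] ω), hM (shift^[n] (w k))]
    have h4 : ∀ i, |(intPart R a (w k) n - intPart R a ω n) i| ≤ (m : ℤ) := by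
      intro i
      have := (norm_le_pi_norm _ i).trans h3
      rw [realVec, Real.norm_eq_abs] at this
      exact_mod_cast this
    simp only [Finset.coe_Icc, Set.mem_Icc, Pi.le_def]
    exact ⟨fun i => (abs_le.1 (h4 i)).1, fun i => (abs_le.1 (h4 i)).2⟩
  -- For `k < l` the code `w l` still follows `ω` at place `k`, where `w k` has already left it.
  · have key : ∀ k ∈ s, ∀ l ∈ s, k < l →
        intPart R a (w k) n ≠ intPart R a (w l) n := by
      intro k hk l hl hkl h
      have h1 := eq_of_intPart_eq hR a ha h k (hlt k hk)
      exact hw3 k hk (h1.trans (hw2 l hl k hkl))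
    intro k hk l hl hkl
    have hkl' : intPart R a (w k) n = intPart R a (w l) n := sub_left_injective hkl
    rcases lt_trichotomy k l with h | h | h
    · exact absurd hkl' (key k hk l hl h)
    · exact h
    · exact absurd hkl'.symm (key l hl k hk h)

/-- Cutting a second code at its first disagreement with `ω` would put a shift of `ω` into the
overlap. -/
lemma eq_of_coding_eq {ω ω' : ℕ → κ} (hω : ∀ k, shift^[k] ω ∉ overlap R a)
    (h : coding R a ω' = coding R a ω) : ω' = ω := by
  classical
  by_contra hne
  have hex : ∃ k, ω' k ≠ ω k := Function.ne_iff.1 hne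
  refine hω (Nat.find hex) ⟨shift^[Nat.find hex] ω', ?_, ?_⟩
  · have h1 := realMat_pow_mulVec_coding hR a ω' (Nat.find hex)
    rw [h, realMat_pow_mulVec_coding hR, intPart_congr (ω := ω') (ω' := ω) a fun k hk =>
      not_not.1 (Nat.find_min hex hk), add_right_inj] at h1
    exact h1.symm
  · rw [iterate_shift, iterate_shift, zero_add]
    exact Nat.find_spec hex

/-- The overlap is the projection of a closed subset of a compact space; closedness is used for its
measurability. -/
lemma isClosed_overlap [TopologicalSpace κ] [DiscreteTopology κ] :
    IsClosed (overlap R a) := by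
  have h1 : overlap R a = Prod.fst '' {p : (ℕ → κ) × (ℕ → κ) |
      coding R a p.2 = coding R a p.1 ∧ p.2 0 ≠ p.1 0} := by
    ext ω
    constructor
    · rintro ⟨ω', h⟩
      exact ⟨(ω, ω'), h, rfl⟩
    · rintro ⟨⟨ω, ω'⟩, h, rfl⟩
      exact ⟨ω', h⟩
  rw [h1]
  have hc := continuous_coding hR a
  have hF : Continuous fun p : (ℕ → κ) × (ℕ → κ) => (p.1 0, p.2 0) := by fun_prop
  have h2 : IsClosed {p : (ℕ → κ) × (ℕ → κ) | p.2 0 ≠ p.1 0} :=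
    (isClosed_discrete {q : κ × κ | q.2 ≠ q.1}).preimage hF
  exact (((isClosed_eq (hc.comp continuous_snd) (hc.comp continuous_fst)).inter
    h2).isCompact.image continuous_fst).isClosed

end Coding

/-! ### Almost sure injectivity of the coding -/

section WordMeasure

variable {N : ℕ} [NeZero N]

instance : IsProbabilityMeasure (uniformMeasure (Finset.univ : Finset (Fin N))) :=
  isProbabilityMeasure_uniformMeasure Finset.univ_nonempty

instance : IsProbabilityMeasure (wordMeasure N) := by
  unfold wordMeasure; infer_instance

lemma measurePreserving_shift :
    MeasurePreserving (shift : (ℕ → Fin N) → _) (wordMeasure N) (wordMeasure N) :=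
  ⟨measurable_pi_lambda _ fun n => measurable_pi_apply (n + 1),
    Measure.map_infinitePi_infinitePi_of_inj (f := fun n : ℕ => n + 1)
      (P := fun _ => uniformMeasure (Finset.univ : Finset (Fin N)))
      (fun _ _ h => Nat.succ_injective h)⟩

variable {ι : Type*} [Fintype ι] [DecidableEq ι] {R : Matrix ι ι ℤ} (hR : IsExpansive R)
  {a : Fin N → ι → ℤ} (ha : ∀ i j z, a i - a j = R *ᵥ z → i = j)
include hR ha

/-- The overlap is negligible, by Poincaré recurrence. -/
lemma wordMeasure_overlap : wordMeasure N (overlap R a) = 0 := by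
  obtain ⟨K, hK⟩ := exists_card_visits_le hR a ha
  -- Almost every word of the overlap returns infinitely often, whereas at most `K` visits are
  -- possible.
  have h := (measurePreserving_shift (N := N)).conservative.ae_mem_imp_frequently_image_mem
    (isClosed_overlap hR a).measurableSet.nullMeasurableSet
  refine measure_mono_null ?_ h
  intro ω hω h1
  have h2 := Nat.frequently_atTop_iff_infinite.1 (h1 hω)
  obtain ⟨s, hs, hcard⟩ := h2.exists_subset_card_eq (K + 1)
  have := hK ω s fun k hk => hs hk
  omega

lemma ae_shift_notMem_overlap :
    ∀ᵐ ω ∂(wordMeasure N), ∀ k, shift^[k] ω ∉ overlap R a := by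
  rw [ae_all_iff]
  intro k
  have h := (measurePreserving_shift (N := N)).iterate k
  exact h.quasiMeasurePreserving.ae (measure_eq_zero_iff_ae_notMem.1 (wordMeasure_overlap hR ha))

/-- Up to null sets, every random variable on the words is a function of the coded point. -/
lemma exists_ae_eq_comp_coding {f : (ℕ → Fin N) → ℂ} (hf : Measurable f) :
    ∃ g : (ι → ℝ) → ℂ, Measurable g ∧ f =ᵐ[wordMeasure N] g ∘ coding R a := by
  set s : Set (ℕ → Fin N) := {ω | ∀ k, shift^[k] ω ∉ overlap R a} with hs
  have hsm : MeasurableSet s := by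
    rw [hs, Set.ofPred_forall]
    refine MeasurableSet.iInter fun k => ?_
    exact ((measurePreserving_shift (N := N)).iterate k).measurable
      (isClosed_overlap hR a).measurableSet.compl
  -- On `s` the coding is injective, and an injective Borel map on a standard Borel space is a
  -- measurable embedding (Lusin–Souslin), so measurable functions on `s` factor through it.
  have := hsm.standardBorel
  have hemb := ((continuous_coding hR a).measurable.comp
    (measurable_subtype_coe : Measurable ((↑) : s → ℕ → Fin N))).measurableEmbedding
    fun ω ω' h => Subtype.ext (eq_of_coding_eq hR a ω'.2 h)
  obtain ⟨g, hg, hgf⟩ := hemb.exists_measurable_extend (hf.comp measurable_subtype_coe)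
    fun _ => ⟨0⟩
  refine ⟨g, hg, ?_⟩
  filter_upwards [ae_shift_notMem_overlap hR ha] with ω hω
  exact (congrFun hgf ⟨ω, hω⟩).symm

end WordMeasure

/-! ### Fourier transforms of infinite convolutions -/

section FourierConvolution

variable {ι : Type*} [Fintype ι]

lemma norm_fourier_le_one (μ : Measure (ι → ℝ)) [IsProbabilityMeasure μ] (ξ : ι → ℝ) :
    ‖fourier μ ξ‖ ≤ 1 := by
  simpa [fourier] using norm_integral_le_of_norm_le_const (μ := μ)
    (ae_of_all _ fun x => (norm_expo ξ x).le)

lemma fourier_conv (μ ν : Measure (ι → ℝ)) [IsFiniteMeasure μ] [IsFiniteMeasure ν]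
    (ξ : ι → ℝ) : fourier (μ.conv ν) ξ = fourier μ ξ * fourier ν ξ := by
  rw [fourier, integral_conv (integrable_expo _ ξ)]
  simp only [expo_add_right, integral_const_mul, integral_mul_const, fourier]

omit [Fintype ι] in
lemma isProbabilityMeasure_finiteConvolution {ν : ℕ → Measure (ι → ℝ)}
    (hν : ∀ n, IsProbabilityMeasure (ν n)) (n : ℕ) :
    IsProbabilityMeasure (finiteConvolution ν n) := by
  induction n with
  | zero => unfold finiteConvolution; infer_instance
  | succ n ih => unfold finiteConvolution; infer_instance

lemma fourier_finiteConvolution {ν : ℕ → Measure (ι → ℝ)}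
    (hν : ∀ n, IsProbabilityMeasure (ν n)) (ξ : ι → ℝ) (n : ℕ) :
    fourier (finiteConvolution ν n) ξ = ∏ k ∈ Finset.range n, fourier (ν k) ξ := by
  induction n with
  | zero => simp [finiteConvolution, fourier]
  | succ n ih =>
    have := isProbabilityMeasure_finiteConvolution hν n
    rw [finiteConvolution, fourier_conv, ih, Finset.prod_range_succ]

/-- Weak convergence is tested on real functions only, so the real and imaginary parts of the
exponential are treated separately. -/
lemma IsInfiniteConvolution.tendsto_fourier {ν : ℕ → Measure (ι → ℝ)} {μ : Measure (ι → ℝ)}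
    (hν : ∀ n, IsProbabilityMeasure (ν n)) (h : IsInfiniteConvolution ν μ) (ξ : ι → ℝ) :
    Tendsto (fun n => ∏ k ∈ Finset.range n, fourier (ν k) ξ) atTop (𝓝 (fourier μ ξ)) := by
  have := h.1
  have hre : Continuous fun x => (expo ξ x).re := Complex.continuous_re.comp (continuous_expo ξ)
  have him : Continuous fun x => (expo ξ x).im := Complex.continuous_im.comp (continuous_expo ξ)
  have h1 := h.2 (BoundedContinuousFunction.ofNormedAddCommGroup _ hre 1
    fun x => (Complex.abs_re_le_norm _).trans (norm_expo ξ x).le)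
  have h2 := h.2 (BoundedContinuousFunction.ofNormedAddCommGroup _ him 1
    fun x => (Complex.abs_im_le_norm _).trans (norm_expo ξ x).le)
  have hF : ∀ (ρ : Measure (ι → ℝ)) [IsProbabilityMeasure ρ], fourier ρ ξ =
      ((∫ x, (expo ξ x).re ∂ρ : ℝ) : ℂ) + ((∫ x, (expo ξ x).im ∂ρ : ℝ) : ℂ) * Complex.I :=
    fun ρ _ => (integral_re_add_im (𝕜 := ℂ) (integrable_expo ρ ξ)).symm
  have hn : ∀ n, ∏ k ∈ Finset.range n, fourier (ν k) ξ =
      ((∫ x, (expo ξ x).re ∂(finiteConvolution ν n) : ℝ) : ℂ)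
        + ((∫ x, (expo ξ x).im ∂(finiteConvolution ν n) : ℝ) : ℂ) * Complex.I := by
    intro n
    have := isProbabilityMeasure_finiteConvolution hν n
    rw [← hF, fourier_finiteConvolution hν]
  simp only [hn]
  rw [hF μ]
  exact ((Complex.continuous_ofReal.tendsto _).comp h1).add
    (((Complex.continuous_ofReal.tendsto _).comp h2).mul_const _)

lemma integral_uniformMeasure {X : Type*} [MeasurableSpace X] [MeasurableSingletonClass X]
    (A : Finset X) (f : X → ℂ) :
    ∫ x, f x ∂(uniformMeasure A) = (A.card : ℂ)⁻¹ * ∑ a ∈ A, f a := by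
  rw [uniformMeasure, integral_smul_measure, integral_finsetSum_measure fun a _ =>
    integrable_dirac (by simp)]
  simp

variable [DecidableEq ι]

lemma fourier_uniformMeasure_scaledDigits {R : Matrix ι ι ℤ} (hR : IsExpansive R) (k : ℕ)
    (B : Finset (ι → ℤ)) (ξ : ι → ℝ) :
    fourier (uniformMeasure (scaledDigits R k B)) ξ
      = (B.card : ℂ)⁻¹ * ∑ b ∈ B, expo ξ (realInv R ^ k *ᵥ realVec b) := by
  have hinj : Function.Injective fun b : ι → ℤ => realInv R ^ k *ᵥ realVec b :=
    (mulVec_realInv_pow_injective hR k).comp realVec_injective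
  rw [fourier, integral_uniformMeasure, scaledDigits, Finset.card_image_of_injective _ hinj,
    Finset.sum_image hinj.injOn]

lemma isProbabilityMeasure_scaledDigits (R : Matrix ι ι ℤ) (k : ℕ) {B : Finset (ι → ℤ)}
    (hB : B.Nonempty) : IsProbabilityMeasure (uniformMeasure (scaledDigits R k B)) :=
  isProbabilityMeasure_uniformMeasure (hB.image _)

/-- A limit of products of averages over the letters is an expectation over the words. -/
lemma tendsto_prod_average {N : ℕ} [NeZero N] {h : ℕ → Fin N → ℂ} (h1 : ∀ k i, ‖h k i‖ ≤ 1)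
    {H : (ℕ → Fin N) → ℂ}
    (hH : ∀ ω, Tendsto (fun n => ∏ k ∈ Finset.range n, h k (ω k)) atTop (𝓝 (H ω))) :
    Tendsto (fun n => ∏ k ∈ Finset.range n, ((N : ℂ)⁻¹ * ∑ i, h k i)) atTop
      (𝓝 (∫ ω, H ω ∂(wordMeasure N))) := by
  have hm : ∀ k, Measurable fun ω : ℕ → Fin N => h k (ω k) := fun k =>
    (Measurable.of_discrete (f := h k)).comp (measurable_pi_apply k)
  have hind : ProbabilityTheory.iIndepFun (fun (k : ℕ) (ω : ℕ → Fin N) => ω k) (wordMeasure N) :=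
    ProbabilityTheory.iIndepFun_infinitePi (X := fun _ x => x) (fun _ => measurable_id)
  have heval : ∀ k, ∫ ω, h k (ω k) ∂(wordMeasure N) = (N : ℂ)⁻¹ * ∑ i, h k i := by
    intro k
    have h3 := Measure.infinitePi_map_eval
      (fun _ : ℕ => uniformMeasure (Finset.univ : Finset (Fin N))) k
    have h4 := integral_map (μ := wordMeasure N) (f := h k)
      (measurable_pi_apply k).aemeasurable (Measurable.of_discrete).aestronglyMeasurable
    rw [← h4, wordMeasure, h3, integral_uniformMeasure]
    simp
  have hn : ∀ n, ∏ k ∈ Finset.range n, ((N : ℂ)⁻¹ * ∑ i, h k i)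
      = ∫ ω, ∏ k ∈ Finset.range n, h k (ω k) ∂(wordMeasure N) := by
    intro n
    -- Independence of the first `n` letters turns the expectation of the product into a product of
    -- averages.
    have h5 := (hind.precomp (g := ((↑) : Fin n → ℕ)) Fin.val_injective).integral_fun_prod_comp
      (f := fun k : Fin n => h k) (fun k => (measurable_pi_apply _).aemeasurable)
      (fun k => Measurable.of_discrete.aestronglyMeasurable)
    simp only [heval] at h5
    rw [Finset.prod_range, ← h5]
    simp only [Finset.prod_range]
  simp only [hn]
  refine tendsto_integral_of_dominated_convergence (fun _ => 1) (fun n => ?_)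
    (integrable_const _) (fun n => ae_of_all _ fun ω => ?_) (ae_of_all _ hH)
  · exact (Finset.measurable_prod _ fun k _ => hm k).aestronglyMeasurable
  · rw [norm_prod]
    exact Finset.prod_le_one (fun _ _ => norm_nonneg _) fun k _ => h1 k _

lemma tendsto_prod_expo_coding {κ : Type*} [Finite κ] {R : Matrix ι ι ℤ} (hR : IsExpansive R)
    (a : κ → ι → ℤ) (ξ : ι → ℝ) (ω : ℕ → κ) :
    Tendsto (fun n => ∏ k ∈ Finset.range n, expo ξ (realInv R ^ (k + 1) *ᵥ realVec (a (ω k))))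
      atTop (𝓝 (expo ξ (coding R a ω))) := by
  have h1 : ∀ n, ∏ k ∈ Finset.range n, expo ξ (realInv R ^ (k + 1) *ᵥ realVec (a (ω k)))
      = expo ξ (∑ k ∈ Finset.range n, realInv R ^ (k + 1) *ᵥ realVec (a (ω k))) := by
    intro n
    induction n with
    | zero => simp
    | succ n ih => rw [Finset.prod_range_succ, ih, Finset.sum_range_succ, expo_add_right]
  simp only [h1]
  exact ((continuous_expo ξ).tendsto _).comp (hasSum_coding hR a ω).tendsto_sum_nat

lemma tendsto_fourier_randomConvolution {κ : Type*} [Finite κ] {R : Matrix ι ι ℤ}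
    (hR : IsExpansive R) {B : κ → Finset (ι → ℤ)} (hB : ∀ i, (B i).Nonempty) (ω : ℕ → κ)
    (ξ : ι → ℝ) :
    Tendsto (fun n => ∏ k ∈ Finset.range n,
      fourier (uniformMeasure (scaledDigits R (k + 1) (B (ω k)))) ξ) atTop
      (𝓝 (fourier (randomConvolution R B ω) ξ)) :=
  (isInfiniteConvolution_randomConvolution hR hB ω).tendsto_fourier
    (fun _ => isProbabilityMeasure_scaledDigits _ _ (hB _)) ξ

lemma measurable_fourier_randomConvolution {N : ℕ} {R : Matrix ι ι ℤ}
    (hR : IsExpansive R) {B : Fin N → Finset (ι → ℤ)} (hB : ∀ i, (B i).Nonempty) (ξ : ι → ℝ) :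
    Measurable fun ω => fourier (randomConvolution R B ω) ξ := by
  refine measurable_of_tendsto_metrizable (fun n => ?_)
    (tendsto_pi_nhds.2 fun ω => tendsto_fourier_randomConvolution hR hB ω ξ)
  exact Finset.measurable_prod _ fun k _ => (Measurable.of_discrete
    (f := fun i => fourier (uniformMeasure (scaledDigits R (k + 1) (B i))) ξ)).comp
      (measurable_pi_apply k)

/-- A self-affine measure is the distribution of the coded point of a random word. -/
lemma selfAffineMeasure_eq_map_coding {N : ℕ} [NeZero N] {R : Matrix ι ι ℤ}
    (hR : IsExpansive R) {a : Fin N → ι → ℤ} (ha : Function.Injective a) :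
    selfAffineMeasure R (Finset.univ.image a) = (wordMeasure N).map (coding R a) := by
  have hne : (Finset.univ.image a).Nonempty := Finset.univ_nonempty.image a
  have hi := isInfiniteConvolution_selfAffineMeasure hR hne
  have := hi.1
  have hc := continuous_coding hR a
  have := Measure.isProbabilityMeasure_map (μ := wordMeasure N) hc.measurable.aemeasurable
  refine ext_of_fourier fun ξ => ?_
  rw [fourier, fourier, integral_map hc.measurable.aemeasurable
    (continuous_expo ξ).measurable.aestronglyMeasurable]
  refine tendsto_nhds_unique (hi.tendsto_fourier
    (fun n => isProbabilityMeasure_scaledDigits _ _ hne) ξ) ?_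
  have h1 := tendsto_prod_average (N := N)
    (h := fun k i => expo ξ (realInv R ^ (k + 1) *ᵥ realVec (a i)))
    (fun _ _ => (norm_expo _ _).le) (tendsto_prod_expo_coding hR a ξ)
  convert h1 using 4 with n k
  rw [fourier_uniformMeasure_scaledDigits hR, Finset.card_image_of_injective _ ha,
    Finset.sum_image ha.injOn, Finset.card_univ, Fintype.card_fin]

end FourierConvolution

/-! ### Block triangular matrices -/

section BlockMatrices

variable {ι κ : Type*} [Fintype ι] [Fintype κ]

lemma expo_sumElim (ξ : ι → ℝ) (η : κ → ℝ) (x : ι ⊕ κ → ℝ) :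
    expo (Sum.elim ξ η) x = expo ξ (x ∘ Sum.inl) * expo η (x ∘ Sum.inr) := by
  rw [expo, expo, expo, ← Complex.exp_add, dotProduct, Fintype.sum_sum_type]
  simp only [Sum.elim_inl, Sum.elim_inr, dotProduct, Function.comp_apply]
  push_cast
  ring_nf

variable [DecidableEq ι] [DecidableEq κ] {R₁ : Matrix ι ι ℤ} {C : Matrix κ ι ℤ}
  {R : Matrix κ κ ℤ}

omit [Fintype ι] [Fintype κ] [DecidableEq ι] [DecidableEq κ] in
lemma realMat_fromBlocks : realMat (Matrix.fromBlocks R₁ 0 C R)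
    = Matrix.fromBlocks (realMat R₁) 0 (C.map (Int.cast : ℤ → ℝ)) (realMat R) := by
  have h0 : (0 : Matrix ι κ ℤ).map (Int.cast : ℤ → ℝ) = 0 := by ext; simp
  rw [realMat, Matrix.fromBlocks_map, h0]; rfl

lemma realInv_pow_fromBlocks_mulVec_inl (hR : IsExpansive (Matrix.fromBlocks R₁ 0 C R))
    (hR₁ : IsExpansive R₁) (n : ℕ) (v : ι ⊕ κ → ℝ) :
    (realInv (Matrix.fromBlocks R₁ 0 C R) ^ n *ᵥ v) ∘ Sum.inl
      = realInv R₁ ^ n *ᵥ (v ∘ Sum.inl) := by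
  have h1 : ∀ v : ι ⊕ κ → ℝ, (realInv (Matrix.fromBlocks R₁ 0 C R) *ᵥ v) ∘ Sum.inl
      = realInv R₁ *ᵥ (v ∘ Sum.inl) := by
    intro v
    set u := realInv (Matrix.fromBlocks R₁ 0 C R) *ᵥ v with hu
    have h2 : realMat (Matrix.fromBlocks R₁ 0 C R) *ᵥ u = v := by
      rw [hu, Matrix.mulVec_mulVec, realMat_mul_realInv hR, Matrix.one_mulVec]
    rw [← h2, realMat_fromBlocks, Matrix.fromBlocks_mulVec, Sum.elim_comp_inl,
      Matrix.zero_mulVec, add_zero, Matrix.mulVec_mulVec, realInv_mul_realMat hR₁,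
      Matrix.one_mulVec]
  induction n with
  | zero => simp
  | succ n ih => rw [pow_succ', ← Matrix.mulVec_mulVec, h1, ih, Matrix.mulVec_mulVec, ← pow_succ']

lemma realInv_pow_fromBlocks_mulVec_sumElim_zero
    (hbig : IsExpansive (Matrix.fromBlocks R₁ 0 C R)) (hR : IsExpansive R) (n : ℕ) (v : κ → ℝ) :
    realInv (Matrix.fromBlocks R₁ 0 C R) ^ n *ᵥ Sum.elim (0 : ι → ℝ) v
      = Sum.elim (0 : ι → ℝ) (realInv R ^ n *ᵥ v) := by
  have h1 : ∀ v : κ → ℝ, realInv (Matrix.fromBlocks R₁ 0 C R) *ᵥ Sum.elim (0 : ι → ℝ) v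
      = Sum.elim (0 : ι → ℝ) (realInv R *ᵥ v) := by
    intro v
    have h2 : realMat (Matrix.fromBlocks R₁ 0 C R) *ᵥ Sum.elim (0 : ι → ℝ) (realInv R *ᵥ v)
        = Sum.elim (0 : ι → ℝ) v := by
      rw [realMat_fromBlocks, Matrix.fromBlocks_mulVec]
      simp [realMat_mul_realInv hR]
    rw [← h2, Matrix.mulVec_mulVec, realInv_mul_realMat hbig, Matrix.one_mulVec]
  induction n with
  | zero => simp
  | succ n ih => rw [pow_succ', ← Matrix.mulVec_mulVec, ih, h1, Matrix.mulVec_mulVec, ← pow_succ']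

/-- The upper right block is zero, so projection to the first component intertwines the two codings.
-/
lemma coding_fromBlocks_inl {A : Type*} [Finite A]
    (hbig : IsExpansive (Matrix.fromBlocks R₁ 0 C R)) (hR₁ : IsExpansive R₁)
    (a : A → ι → ℤ) (b : A → κ → ℤ) (ω : ℕ → A) :
    coding (Matrix.fromBlocks R₁ 0 C R) (fun i => Sum.elim (a i) (b i)) ω ∘ Sum.inl
      = coding R₁ a ω := by
  have h := (hasSum_coding hbig (fun i => Sum.elim (a i) (b i)) ω).map
    (LinearMap.funLeft ℝ ℝ (Sum.inl : ι → ι ⊕ κ)).toAddMonoidHom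
    (LinearMap.continuous_of_finiteDimensional (LinearMap.funLeft ℝ ℝ (Sum.inl : ι → ι ⊕ κ)))
  refine h.unique ?_
  convert hasSum_coding hR₁ a ω using 1
  funext k
  exact realInv_pow_fromBlocks_mulVec_inl hbig hR₁ _ _

end BlockMatrices

/-! ### Disintegration over the first component -/

variable {r d N : ℕ}
  {bigR : Matrix (Fin r ⊕ Fin d) (Fin r ⊕ Fin d) ℤ} {bigB bigL : Finset (Fin r ⊕ Fin d → ℤ)}
  {R₁ : Matrix (Fin r) (Fin r) ℤ} {a : Fin N → Fin r → ℤ} {L₁ : Finset (Fin r → ℤ)}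
  {R : Matrix (Fin d) (Fin d) ℤ} {B : Fin N → Finset (Fin d → ℤ)} {L : Finset (Fin d → ℤ)}

namespace IsQuasiProductForm

variable (h : IsQuasiProductForm bigR bigB bigL R₁ a L₁ R B L)
include h

lemma neZero : NeZero N := by
  obtain ⟨i, -⟩ := Finset.mem_image.1 h.hadamard_first.zero_mem_digits
  exact ⟨i.pos.ne'⟩

lemma isExpansive_second : IsExpansive R :=
  have := h.neZero
  (h.hadamard 0).expansive

lemma nonempty_digits (i : Fin N) : (B i).Nonempty := ⟨0, (h.hadamard i).zero_mem_digits⟩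

lemma eq_of_sub_eq_mulVec (i j : Fin N) (z : Fin r → ℤ) (hz : a i - a j = R₁ *ᵥ z) : i = j :=
  h.injective_first (h.hadamard_first.eq_of_sub_eq_mulVec
    (Finset.mem_image_of_mem _ (Finset.mem_univ i))
    (Finset.mem_image_of_mem _ (Finset.mem_univ j)) hz)

lemma sum_digits (F : (Fin r ⊕ Fin d → ℤ) → ℂ) :
    ∑ v ∈ bigB, F v = ∑ i, ∑ b ∈ B i, F (Sum.elim (a i) b) := by
  rw [Finset.sum_sigma']
  symm
  refine Finset.sum_bij (fun p _ => Sum.elim (a p.1) p.2) (fun p hp => ?_) (fun p _ q _ hpq => ?_)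
    (fun v hv => ?_) (fun _ _ => rfl)
  · exact (h.mem_digits_iff _).2 ⟨p.1, p.2, (Finset.mem_sigma.1 hp).2, rfl⟩
  · obtain ⟨i, b⟩ := p
    obtain ⟨j, c⟩ := q
    have h1 : a i = a j := by simpa using congrArg (· ∘ Sum.inl) hpq
    have h2 : b = c := by simpa using congrArg (· ∘ Sum.inr) hpq
    rw [h.injective_first h1, h2]
  · obtain ⟨i, b, hb, rfl⟩ := (h.mem_digits_iff v).1 hv
    exact ⟨⟨i, b⟩, Finset.mem_sigma.2 ⟨Finset.mem_univ _, hb⟩, rfl⟩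

lemma card_digits : (bigB.card : ℂ) = N * L.card := by
  have h1 := h.sum_digits fun _ => 1
  simpa [(h.hadamard _).card_eq] using h1

/-- Splitting `(a i, b) = (a i, 0) + (0, b)` separates a phase from the average over `B i`. All `B
i` have the cardinality of `L`, so the letters get equal weight `1/N`. -/
lemma fourier_digits (k : ℕ) (ξ : Fin r → ℝ) (η : Fin d → ℝ) :
    fourier (uniformMeasure (scaledDigits bigR k bigB)) (Sum.elim ξ η)
      = (N : ℂ)⁻¹ * ∑ i, expo (Sum.elim ξ η) (realInv bigR ^ k *ᵥ realVec (Sum.elim (a i) 0))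
        * fourier (uniformMeasure (scaledDigits R k (B i))) η := by
  have hbig := h.isExpansive
  rw [fourier_uniformMeasure_scaledDigits hbig, h.card_digits, h.sum_digits, mul_inv, mul_assoc,
    Finset.mul_sum]
  congr 1
  refine Finset.sum_congr rfl fun i _ => ?_
  rw [fourier_uniformMeasure_scaledDigits h.isExpansive_second, (h.hadamard i).card_eq,
    mul_left_comm]
  congr 1
  rw [Finset.mul_sum]
  refine Finset.sum_congr rfl fun b _ => ?_
  have h1 : realVec (Sum.elim (a i) b)
      = realVec (Sum.elim (a i) 0) + Sum.elim (0 : Fin r → ℝ) (realVec b) := by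
    funext j
    cases j <;> simp [realVec]
  obtain ⟨C, rfl⟩ := h.matrix_eq
  rw [h1, Matrix.mulVec_add, expo_add_right,
    realInv_pow_fromBlocks_mulVec_sumElim_zero hbig h.isExpansive_second, expo_sumElim ξ η
      (Sum.elim (0 : Fin r → ℝ) _), Sum.elim_comp_inl, Sum.elim_comp_inr, expo_zero_right, one_mul]

/-- The disintegration of the Fourier transform of the measure of a quasi-product form. -/
lemma fourier_selfAffineMeasure (ξ : Fin r → ℝ) (η : Fin d → ℝ) :
    fourier (selfAffineMeasure bigR bigB) (Sum.elim ξ η)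
      = ∫ ω, expo (Sum.elim ξ η) (coding bigR (fun i => Sum.elim (a i) 0) ω)
        * fourier (randomConvolution R B ω) η ∂(wordMeasure N) := by
  have := h.neZero
  have hne : bigB.Nonempty := by
    obtain ⟨b, hb⟩ := h.nonempty_digits 0
    exact ⟨_, (h.mem_digits_iff _).2 ⟨0, b, hb, rfl⟩⟩
  refine tendsto_nhds_unique ((isInfiniteConvolution_selfAffineMeasure h.isExpansive
    hne).tendsto_fourier (fun n => isProbabilityMeasure_scaledDigits _ _ hne) _) ?_
  simp only [h.fourier_digits]
  refine tendsto_prod_average (h := fun k i => expo (Sum.elim ξ η)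
    (realInv bigR ^ (k + 1) *ᵥ realVec (Sum.elim (a i) 0))
      * fourier (uniformMeasure (scaledDigits R (k + 1) (B i))) η) (fun k i => ?_) fun ω => ?_
  · have := isProbabilityMeasure_scaledDigits R (k + 1) (h.nonempty_digits i)
    rw [norm_mul, norm_expo, one_mul]
    exact norm_fourier_le_one _ _
  · simp only [Finset.prod_mul_distrib]
    exact (tendsto_prod_expo_coding h.isExpansive (fun i => Sum.elim (a i) 0) _ ω).mul
      (tendsto_fourier_randomConvolution h.isExpansive_second h.nonempty_digits ω η)

/-- Parseval's identity in the first component, for a fixed frequency in the second. -/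
lemma tsum_enorm_fourier_sq {Λ₁ : Set (Fin r → ℝ)}
    (hΛ₁ : IsSpectrum (selfAffineMeasure R₁ (Finset.univ.image a)) Λ₁)
    (ξ : Fin r → ℝ) (η : Fin d → ℝ) :
    ∑' l : Λ₁, ‖fourier (selfAffineMeasure bigR bigB) (Sum.elim (ξ - l) η)‖ₑ ^ 2
      = ∫⁻ ω, ‖fourier (randomConvolution R B ω) η‖ₑ ^ 2 ∂(wordMeasure N) := by
  have := h.neZero
  have hR₁ := h.hadamard_first.expansive
  have hX := continuous_coding h.isExpansive fun i => Sum.elim (a i) (0 : Fin d → ℤ)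
  have hx := continuous_coding hR₁ a
  set G : (ℕ → Fin N) → ℂ := fun ω =>
    expo η (coding bigR (fun i => Sum.elim (a i) 0) ω ∘ Sum.inr)
      * fourier (randomConvolution R B ω) η with hG
  have hGm : Measurable G := by
    refine Measurable.mul (Continuous.measurable ?_)
      (measurable_fourier_randomConvolution h.isExpansive_second h.nonempty_digits η)
    exact (continuous_expo η).comp (continuous_pi fun j => (continuous_apply (Sum.inr j)).comp hX)
  have hprob := fun ω => (isInfiniteConvolution_randomConvolution h.isExpansive_second
    h.nonempty_digits ω).1
  have hG1 : ∀ ω, ‖G ω‖ = ‖fourier (randomConvolution R B ω) η‖ := fun ω => by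
    rw [hG, norm_mul, norm_expo, one_mul]
  -- Almost sure injectivity enters here: `G` becomes a function `g` of the first component, to
  -- which Parseval in `L²(μ₁)` applies.
  obtain ⟨g, hgm, hg⟩ := exists_ae_eq_comp_coding hR₁ h.eq_of_sub_eq_mulVec hGm
  rw [selfAffineMeasure_eq_map_coding hR₁ h.injective_first] at hΛ₁
  have := Measure.isProbabilityMeasure_map (μ := wordMeasure N) hx.measurable.aemeasurable
  have hfm : Measurable fun y => expo ξ y * g y := (continuous_expo ξ).measurable.mul hgm
  have hf : MemLp (fun y => expo ξ y * g y) 2 ((wordMeasure N).map (coding R₁ a)) := by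
    refine MemLp.of_bound hfm.aestronglyMeasurable 1 ?_
    rw [ae_map_iff hx.measurable.aemeasurable (measurableSet_le hfm.norm measurable_const)]
    filter_upwards [hg] with ω hω
    have h1 := hG1 ω
    rw [hω, Function.comp_apply] at h1
    rw [norm_mul, norm_expo, one_mul, h1]
    exact norm_fourier_le_one _ _
  have hP := hΛ₁.tsum_enorm_integral_sq hf
  rw [lintegral_map (hfm.enorm.pow_const 2) hx.measurable] at hP
  convert hP using 1
  · refine tsum_congr fun l => ?_
    rw [h.fourier_selfAffineMeasure, integral_map
      (f := fun y => expo (-(l : Fin r → ℝ)) y * (expo ξ y * g y)) hx.measurable.aemeasurable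
      ((continuous_expo _).measurable.mul hfm).aestronglyMeasurable]
    congr 2
    refine integral_congr_ae ?_
    filter_upwards [hg] with ω hω
    have h1 : coding bigR (fun i => Sum.elim (a i) 0) ω ∘ Sum.inl = coding R₁ a ω := by
      have hbig := h.isExpansive
      obtain ⟨C, rfl⟩ := h.matrix_eq
      exact coding_fromBlocks_inl hbig hR₁ a (fun _ => 0) ω
    rw [expo_sumElim, h1, mul_assoc, ← mul_assoc (expo (-(l : Fin r → ℝ)) (coding R₁ a ω)),
      ← expo_add_left, ← sub_eq_neg_add]
    congr 1
  · refine lintegral_congr_ae ?_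
    filter_upwards [hg] with ω hω
    have h1 := hG1 ω
    rw [hω, Function.comp_apply] at h1
    rw [← ofReal_norm, ← ofReal_norm, ← h1, norm_mul, norm_expo, one_mul]

/-- Parseval over `Λ₁` for each fixed `λ₂`, then Tonelli over the countable set `Λ₂`; the result
does not depend on `ξ`. -/
lemma spectralSum_prodSet {Λ₁ : Set (Fin r → ℝ)}
    (hΛ₁ : IsSpectrum (selfAffineMeasure R₁ (Finset.univ.image a)) Λ₁)
    {Λ₂ : Set (Fin d → ℝ)} (hΛ₂ : Λ₂.Countable) (ξ : Fin r → ℝ) (η : Fin d → ℝ) :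
    spectralSum (selfAffineMeasure bigR bigB) (prodSet Λ₁ Λ₂) (Sum.elim ξ η)
      = ∫⁻ ω, spectralSum (randomConvolution R B ω) Λ₂ η ∂(wordMeasure N) := by
  have := hΛ₂.to_subtype
  have hinj : Function.Injective fun p : Λ₂ × Λ₁ =>
      (Sum.elim (p.2 : Fin r → ℝ) (p.1 : Fin d → ℝ)) := by
    intro p q hpq
    have h1 : (p.2 : Fin r → ℝ) = q.2 := by simpa using congrArg (· ∘ Sum.inl) hpq
    have h2 : (p.1 : Fin d → ℝ) = q.1 := by simpa using congrArg (· ∘ Sum.inr) hpq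
    exact Prod.ext (Subtype.ext h2) (Subtype.ext h1)
  have hrange : Set.range (fun p : Λ₂ × Λ₁ =>
      (Sum.elim (p.2 : Fin r → ℝ) (p.1 : Fin d → ℝ))) = prodSet Λ₁ Λ₂ := by
    ext v
    constructor
    · rintro ⟨p, rfl⟩
      exact ⟨p.2, p.2.2, p.1, p.1.2, rfl⟩
    · rintro ⟨k, hk, l, hl, rfl⟩
      exact ⟨(⟨l, hl⟩, ⟨k, hk⟩), rfl⟩
  rw [spectralSum, ← hrange, tsum_range (g := fun p : Λ₂ × Λ₁ =>
      (Sum.elim (p.2 : Fin r → ℝ) (p.1 : Fin d → ℝ)))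
    (fun v => ‖fourier (selfAffineMeasure bigR bigB) (Sum.elim ξ η - v)‖ₑ ^ 2) hinj,
    ENNReal.tsum_prod (f := fun (l : Λ₂) (k : Λ₁) => ‖fourier (selfAffineMeasure bigR bigB)
      (Sum.elim ξ η - Sum.elim (k : Fin r → ℝ) (l : Fin d → ℝ))‖ₑ ^ 2)]
  have hsub : ∀ (k : Fin r → ℝ) (l : Fin d → ℝ),
      (Sum.elim ξ η - Sum.elim k l : Fin r ⊕ Fin d → ℝ) = Sum.elim (ξ - k) (η - l) := by
    intro k l
    funext j
    cases j <;> simp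
  simp only [hsub, h.tsum_enorm_fourier_sq hΛ₁, spectralSum]
  rw [lintegral_tsum]
  exact fun l => ((measurable_fourier_randomConvolution h.isExpansive_second h.nonempty_digits
    _).enorm.pow_const 2).aemeasurable

lemma measurable_spectralSum {Λ₂ : Set (Fin d → ℝ)} (hΛ₂ : Λ₂.Countable) (η : Fin d → ℝ) :
    Measurable fun ω => spectralSum (randomConvolution R B ω) Λ₂ η := by
  have := hΛ₂.to_subtype
  exact Measurable.tsum fun l => (measurable_fourier_randomConvolution
    h.isExpansive_second h.nonempty_digits _).enorm.pow_const 2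

end IsQuasiProductForm

end QuasiProduct

/-! ### The equivalence -/

theorem mainTheorem2 {r d N : ℕ}
    (bigR : Matrix (Fin r ⊕ Fin d) (Fin r ⊕ Fin d) ℤ) (bigB bigL : Finset (Fin r ⊕ Fin d → ℤ))
    (R₁ : Matrix (Fin r) (Fin r) ℤ) (a : Fin N → Fin r → ℤ) (L₁ : Finset (Fin r → ℤ))
    (R : Matrix (Fin d) (Fin d) ℤ) (B : Fin N → Finset (Fin d → ℤ)) (L : Finset (Fin d → ℤ))
    (hform : QuasiProduct.IsQuasiProductForm bigR bigB bigL R₁ a L₁ R B L)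
    (Λ₁ : Set (Fin r → ℝ)) (Λ₂ : Set (Fin d → ℝ))
    (hΛ₁ : QuasiProduct.IsSpectrum
      (QuasiProduct.selfAffineMeasure R₁ (Finset.univ.image a)) Λ₁) :
    QuasiProduct.IsSpectrum (QuasiProduct.selfAffineMeasure bigR bigB)
        (QuasiProduct.prodSet Λ₁ Λ₂) ↔
      ∀ᵐ ω ∂(QuasiProduct.wordMeasure N),
        QuasiProduct.IsSpectrum (QuasiProduct.randomConvolution R B ω) Λ₂ := by
  open QuasiProduct in
  have := hform.neZero
  have hprob := fun ω => (isInfiniteConvolution_randomConvolution hform.isExpansive_second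
    hform.nonempty_digits ω).1
  have hbigprob : IsProbabilityMeasure (selfAffineMeasure bigR bigB) := by
    obtain ⟨b, hb⟩ := hform.nonempty_digits 0
    exact (isInfiniteConvolution_selfAffineMeasure hform.isExpansive
      ⟨_, (hform.mem_digits_iff _).2 ⟨0, b, hb, rfl⟩⟩).1
  have hprob₁ : IsProbabilityMeasure (selfAffineMeasure R₁ (Finset.univ.image a)) :=
    (isInfiniteConvolution_selfAffineMeasure hform.hadamard_first.expansive
      ⟨0, hform.hadamard_first.zero_mem_digits⟩).1
  constructor
  · intro h
    -- Countability of `Λ₂` is not assumed; a point of `Λ₁` exhibits `Λ₂` inside a projection of the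
    -- countable product set.
    obtain ⟨l₁, hl₁⟩ : Λ₁.Nonempty := by
      by_contra hne
      have h1 := hΛ₁.spectralSum_eq_one 0
      rw [Set.not_nonempty_iff_eq_empty.1 hne, spectralSum, tsum_empty] at h1
      exact zero_ne_one h1
    have hΛ₂ : Λ₂.Countable := by
      refine (h.1.image (fun v => v ∘ Sum.inr)).mono fun l hl => ?_
      exact ⟨_, ⟨l₁, hl₁, l, hl, rfl⟩, Sum.elim_comp_inr _ _⟩
    have hone : ∀ η, ∫⁻ ω, spectralSum (randomConvolution R B ω) Λ₂ η ∂(wordMeasure N) = 1 :=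
      fun η => by rw [← hform.spectralSum_prodSet hΛ₁ hΛ₂ 0 η, h.spectralSum_eq_one]
    have hm := hform.measurable_spectralSum hΛ₂
    have hmem : ∀ᵐ ω ∂(wordMeasure N), ∀ η ∈ Λ₂,
        spectralSum (randomConvolution R B ω) Λ₂ η = 1 := by
      rw [ae_ball_iff hΛ₂]
      intro η hη
      have h1 := ae_eq_of_ae_le_of_lintegral_le (μ := wordMeasure N) (f := fun _ => 1)
        (g := fun ω => spectralSum (randomConvolution R B ω) Λ₂ η)
        (ae_of_all _ fun ω => one_le_spectralSum hη) (by simp) (hm η).aemeasurable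
        (by rw [hone η]; simp)
      filter_upwards [h1] with ω hω using hω.symm
    -- The exceptional null set depends on `η`, so only countably many test frequencies can be
    -- handled at once.
    obtain ⟨D, hDc, hD⟩ := TopologicalSpace.exists_countable_dense (Fin d → ℝ)
    have hdense : ∀ᵐ ω ∂(wordMeasure N), ∀ η ∈ D,
        spectralSum (randomConvolution R B ω) Λ₂ η = 1 := by
      rw [ae_ball_iff hDc]
      intro η _
      refine ae_eq_of_ae_le_of_lintegral_le (g := fun _ => 1) ?_ ?_ aemeasurable_const ?_
      · filter_upwards [hmem] with ω hω using spectralSum_le_one hω η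
      · simp [hone η]
      · simp [hone η]
    filter_upwards [hmem, hdense] with ω h1 h2
    exact isSpectrum_of_spectralSum hΛ₂ h1 hD h2
  · intro h
    obtain ⟨ω₀, hω₀⟩ := h.exists
    have hΛ₂ := hω₀.1
    have hone : ∀ ξ, spectralSum (selfAffineMeasure bigR bigB) (prodSet Λ₁ Λ₂) ξ = 1 := by
      intro ξ
      rw [← Sum.elim_comp_inl_inr ξ, hform.spectralSum_prodSet hΛ₁ hΛ₂,
        lintegral_congr_ae (g := fun _ => 1)]
      · simp
      · filter_upwards [h] with ω hω using hω.spectralSum_eq_one _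
    exact isSpectrum_of_spectralSum (hΛ₁.1.image2 hΛ₂ _) (fun ξ _ => hone ξ) dense_univ
      fun ξ _ => hone ξ
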